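/- A locally-iterative coloring algorithm consists, for all $n,\Delta\in\mathbb N$, of a function $\mathrm{Init}_{n,\Delta}$ from identifiers to colors and a function $\mathrm{Update}_{n,\Delta}$ from pairs (color, finite multiset of colors) to colors, where colors are natural numbers. On an $n$-vertex graph $G=(V,E)$ of maximum degree $\Delta$ whose vertices have distinct identifiers $\mathrm{id}(v)\in\{0,\dots,n-1\}$ it computes the colorings $$\phi_0(v)=\mathrm{Init}_{n,\Delta}(\mathrm{id}(v)),\qquad \phi_{t}(v)=\mathrm{Update}_{n,\Delta}\bigl(\phi_{t-1}(v),\{\phi_{t-1}(u): u\in N(v)\}\bigr)\quad(t\ge 1),$$ where $\{\cdot\}$ is a multiset; in round $t$ every vertex $v$ broadcasts $\phi_{t-1}(v)$, written in binary, to its neighbors, and the algorithm is required to keep $\phi_t$ a proper coloring of $G$ for every $t\ge 0$. Theorem. There are a locally-iterative coloring algorithm and an absolute constant $C$ such that, for every finite simple graph $G$ with $n$ vertices and maximum degree $\Delta$ and every assignment of distinct identifiers from $\{0,\dots,n-1\}$ to its vertices: 1. every coloring $\phi_t$, $t\ge 0$, is proper; 2. every message (that is, every color $\phi_t(v)$)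 has at most $C\log n$ bits; 3. for some $T\le C\,\Delta^{3/4}\log\Delta+\log^* n$, all colors $\phi_T(v)$ lie in $\{0,\dots,\Delta\}$ and $\phi_t=\phi_T$ for all $t\ge T$; that is, within $O(\Delta^{3/4}\log\Delta)+\log^* n$ rounds the algorithm has produced a proper $(\Delta+1)$-coloring. Here $\log$ is the logarithm to base $2$, $\Delta^{3/4}\log\Delta$ is read as $0$ for $\Delta=0$, the color $0$ is written with $0$ bits, and $\log^* n$ is the least number of times that $\log$ has to be applied to $n$ to reach a number that is at most $1$. -/

import Mathlib

/-- A locally-iterative colouring rule, with colours coded as natural numbers: `init` gives the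
initial colour of a vertex from its identifier, and `update` gives the next colour of a vertex from
its own colour and the multiset of the colours of its neighbours. It sees neither the round number
nor (after the initial round) the identifier. -/
structure LocallyIterativeRule where
  /-- initial colour, from the identifier -/
  init : ℕ → ℕ
  /-- next colour, from the current colour and the multiset of the neighbours' current colours -/
  update : ℕ → Multiset ℕ → ℕ

/-- The colour of each vertex of `G` after `t` synchronous rounds, when every vertex `v` has the
identifier `ident v` and in each round broadcasts its colour to its neighbours. -/
def LocallyIterativeRule.color {V : Type*} [Fintype V] (A : LocallyIterativeRule)
    (G : SimpleGraph V) [DecidableRel G.Adj] (ident : V → ℕ) : ℕ → V → ℕ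
  | 0, v => A.init (ident v)
  | t + 1, v =>
      A.update (A.color G ident t v) ((G.neighborFinset v).val.map (A.color G ident t))

/-- `φ` is a proper colouring of `G`. -/
def IsProperColoring {V : Type*} (G : SimpleGraph V) (φ : V → ℕ) : Prop :=
  ∀ u v : V, G.Adj u v → φ u ≠ φ v

/-- The iterated logarithm `log* n`: the least number of applications of the base-2 logarithm that
takes `n` to a real number that is at most `1`. -/
noncomputable def logStar (n : ℕ) : ℕ :=
  sInf {k : ℕ | (Real.logb 2)^[k] (n : ℝ) ≤ 1}

/-- The set in the definition of `logStar` is not empty. -/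
theorem logStar_spec (n : ℕ) : (Real.logb 2)^[logStar n] (n : ℝ) ≤ 1 := by
  have key : ∀ m : ℕ, ∀ x : ℝ, x ≤ m → ∃ k : ℕ, (Real.logb 2)^[k] x ≤ 1 := by
    intro m
    induction m with
    | zero => intro x hx; exact ⟨0, by simpa using hx.trans (by norm_num)⟩
    | succ m ih =>
      intro x hx
      by_cases h1 : x ≤ 1
      · exact ⟨0, by simpa using h1⟩
      push Not at h1
      by_cases h2 : x ≤ 2
      · refine ⟨1, ?_⟩
        rw [Function.iterate_one, Real.logb_le_iff_le_rpow (by norm_num) (by linarith)]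
        simpa using h2
      push Not at h2
      have hb : Real.logb 2 x ≤ m := by
        rw [Real.logb_le_iff_le_rpow (by norm_num) (by linarith), Real.rpow_natCast]
        have : m + 1 ≤ 2 ^ m := Nat.lt_two_pow_self
        have h3 : ((m + 1 : ℕ) : ℝ) ≤ ((2 ^ m : ℕ) : ℝ) := by exact_mod_cast this
        push_cast at h3 hx
        linarith
      obtain ⟨k, hk⟩ := ih _ hb
      exact ⟨k + 1, by simpa using hk⟩
  exact Nat.sInf_mem (key n n le_rfl)

/-!
Write `b` for the fourth root of `Δ`. The colours of a locally-iterative algorithm have `O(log n)`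
bits, which is enough for a vertex to broadcast a round counter, a proper colour `psi` and some
auxiliary numbers; since `psi` is part of the message, all intermediate colourings are proper
(`ruleOfRounds`, `ruleOfRounds_spec`). So it suffices to give a synchronous algorithm with short
memories that finds a proper colouring with `Δ + 1` colours in `O(b ^ 3) + log* n` rounds.
Everything rests on assigning to each colour `psi` a polynomial of degree at most `d + 1` over a
prime field, such that the polynomials of different colours, even when shifted by constants, agree
in at most `d + 1` points (`card_filter_polyVal_add_eq_le`).

* Linial's reduction produces `O(Δ ^ 4)` colours in `log* n - 1` rounds (`linialCount_le`). From
  then on `d` is a constant.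
* In `O(b ^ 3)` rounds the vertices are distributed to `O(b ^ 3)` classes: in round `i` the vertex
  `v` tries the value of its polynomial at `i`, and joins this class if at most `b` neighbours are
  in the way. Each neighbour is in the way at most `2 * (d + 1)` times, so all vertices succeed
  (`trial_lt`). In its class a vertex has at most `b` out-neighbours, namely neighbours that
  joined no later (`trial_outdegree_le`).
* The classes are processed one after the other, in two rounds each. The colours `0, …, Δ` are
  points of the plane over a field with `p = O(b ^ 2)` elements. A vertex with `L` free colours
  shifts its polynomial so that its graph contains at least `L / p` free colours (`exists_shift`),
  and then chooses one of them that is on no graph of an out-neighbour. This works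
  whenever `p * b * (d + 1) < L` (`classRounds_spec`), so that the vertices that fail have `O(b ^ 3)` free
  colours, hence `O(b ^ 3)` uncoloured neighbours (`card_uncolored_lt_card_freeColors`).
* Now the distribution to `O(b ^ 3)` classes is repeated for the uncoloured vertices, with no
  conflict allowed. The classes are independent sets, and colour themselves greedily
  (`greedyRounds_spec`).
-/

/-! ### Polynomials that encode colours -/

open Polynomial in
/-- The polynomial `X ^ (d + 1) + ∑ a_i X ^ (i + 1)` over `ZMod q`, where `a_0, …, a_{d-1}` are
the base-`q` digits of `a`. The leading term makes it nonconstant, also for `a = 0`; the constant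
term is left out so that polynomials with different digits differ by more than a constant. -/
noncomputable def digitPoly (q d a : ℕ) : (ZMod q)[X] :=
  X ^ (d + 1) + ∑ i ∈ Finset.range d, C ((a / q ^ i % q : ℕ) : ZMod q) * X ^ (i + 1)

/-- The value at `x` of the polynomial that encodes the colour `a`. -/
noncomputable def polyVal (q d a x : ℕ) : ZMod q := (digitPoly q d a).eval (x : ZMod q)

theorem natDegree_digitPoly_le (q d a : ℕ) : (digitPoly q d a).natDegree ≤ d + 1 := by
  unfold digitPoly
  refine Polynomial.natDegree_add_le_of_degree_le (Polynomial.natDegree_X_pow_le _) ?_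
  refine Polynomial.natDegree_sum_le_of_forall_le _ _ fun i hi => ?_
  refine (Polynomial.natDegree_C_mul_X_pow_le _ _).trans ?_
  have := Finset.mem_range.1 hi
  omega

theorem coeff_digitPoly_of_lt {q d i : ℕ} (a : ℕ) (hi : i < d) :
    (digitPoly q d a).coeff (i + 1) = ((a / q ^ i % q : ℕ) : ZMod q) := by
  simp only [digitPoly, Polynomial.coeff_add, Polynomial.coeff_X_pow, Polynomial.finsetSum_coeff,
    Polynomial.coeff_C_mul]
  rw [if_neg (by omega), Finset.sum_eq_single i]
  · simp
  · intro j _ hj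
    rw [if_neg (by omega), mul_zero]
  · intro h
    exact absurd (Finset.mem_range.2 hi) h

theorem coeff_digitPoly_top (q d a : ℕ) : (digitPoly q d a).coeff (d + 1) = 1 := by
  simp only [digitPoly, Polynomial.coeff_add, Polynomial.coeff_X_pow, Polynomial.finsetSum_coeff,
    Polynomial.coeff_C_mul]
  rw [Finset.sum_eq_zero]
  · simp
  · intro j hj
    have := Finset.mem_range.1 hj
    rw [if_neg (by omega), mul_zero]

theorem eq_of_digits_eq {q : ℕ} (d : ℕ) : ∀ a b : ℕ, a < q ^ d → b < q ^ d →
    (∀ i < d, a / q ^ i % q = b / q ^ i % q) → a = b := by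
  induction d with
  | zero => intro a b ha hb _; simp at ha hb; omega
  | succ d ih =>
    intro a b ha hb h
    have h0 := h 0 (by omega)
    simp only [pow_zero, Nat.div_one] at h0
    have h1 : a / q = b / q := by
      refine ih _ _ ?_ ?_ fun i hi => ?_
      · exact Nat.div_lt_of_lt_mul (by rwa [pow_succ, mul_comm] at ha)
      · exact Nat.div_lt_of_lt_mul (by rwa [pow_succ, mul_comm] at hb)
      · have := h (i + 1) (by omega)
        rwa [pow_succ', ← Nat.div_div_eq_div_mul, ← Nat.div_div_eq_div_mul] at this
    rw [← Nat.div_add_mod a q, ← Nat.div_add_mod b q, h0, h1]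

theorem natCast_zmod_injOn (q : ℕ) :
    Set.InjOn (fun x : ℕ => (x : ZMod q)) (Finset.range q : Set ℕ) := by
  intro x hx y hy h
  have hx := Finset.mem_range.1 (Finset.mem_coe.1 hx)
  have hy := Finset.mem_range.1 (Finset.mem_coe.1 hy)
  have h' := (ZMod.natCast_eq_natCast_iff' x y q).1 h
  rwa [Nat.mod_eq_of_lt hx, Nat.mod_eq_of_lt hy] at h'

open Polynomial in
theorem card_filter_eval_eq_zero_le {q k : ℕ} (hq : q.Prime) {P : (ZMod q)[X]} (hP : P ≠ 0)
    (hk : P.natDegree ≤ k) :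
    ((Finset.range q).filter fun x : ℕ => P.eval (x : ZMod q) = 0).card ≤ k := by
  have := Fact.mk hq
  calc _ ≤ P.roots.toFinset.card := by
        refine Finset.card_le_card_of_injOn (fun x : ℕ => (x : ZMod q)) ?_ ?_
        · intro x hx
          have := (Finset.mem_filter.1 (Finset.mem_coe.1 hx)).2
          simpa [hP] using this
        · exact (natCast_zmod_injOn q).mono fun x hx =>
            Finset.mem_coe.2 (Finset.mem_filter.1 (Finset.mem_coe.1 hx)).1
    _ ≤ P.roots.card := Multiset.toFinset_card_le _
    _ ≤ k := (P.card_roots').trans hk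

theorem card_filter_polyVal_eq_const_le {q : ℕ} (hq : q.Prime) (d a : ℕ) (c : ZMod q) :
    ((Finset.range q).filter fun x => polyVal q d a x = c).card ≤ d + 1 := by
  have := Fact.mk hq
  have h := card_filter_eval_eq_zero_le hq (k := d + 1) (P := digitPoly q d a - Polynomial.C c)
    ?_ ?_
  · refine le_trans (Finset.card_le_card ?_) h
    intro x hx
    obtain ⟨hx, hx'⟩ := Finset.mem_filter.1 hx
    refine Finset.mem_filter.2 ⟨hx, ?_⟩
    rw [Polynomial.eval_sub, Polynomial.eval_C, sub_eq_zero]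
    exact hx'
  · intro h0
    have := congrArg (fun P => P.coeff (d + 1)) h0
    simp [coeff_digitPoly_top] at this
  · exact (Polynomial.natDegree_sub_C).trans_le (natDegree_digitPoly_le q d a)

/-- Two shifted polynomials of different colours agree in few points, whatever the shifts are:
their difference is not constant because the digits, which are the coefficients of `X, …, X ^ d`,
differ. -/
theorem card_filter_polyVal_add_eq_le {q d a b : ℕ} (hq : q.Prime) (ha : a < q ^ d)
    (hb : b < q ^ d) (hab : a ≠ b) (r s : ZMod q) :
    ((Finset.range q).filter fun x => polyVal q d a x + r = polyVal q d b x + s).card ≤ d + 1 := by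
  have := Fact.mk hq
  have h := card_filter_eval_eq_zero_le hq (k := d + 1)
    (P := digitPoly q d a - digitPoly q d b - Polynomial.C (s - r)) ?_ ?_
  · refine le_trans (Finset.card_le_card ?_) h
    intro x hx
    obtain ⟨hx, hx'⟩ := Finset.mem_filter.1 hx
    refine Finset.mem_filter.2 ⟨hx, ?_⟩
    simp only [polyVal] at hx'
    simp only [Polynomial.eval_sub, Polynomial.eval_C]
    linear_combination hx'
  · intro h0
    refine hab (eq_of_digits_eq d a b ha hb fun i hi => ?_)
    have := congrArg (fun P => P.coeff (i + 1)) h0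
    simp only [Polynomial.coeff_sub, coeff_digitPoly_of_lt _ hi, Polynomial.coeff_zero,
      Polynomial.coeff_C, Nat.succ_ne_zero, if_false, sub_zero, sub_eq_zero] at this
    exact natCast_zmod_injOn q (by simpa using Nat.mod_lt _ hq.pos)
      (by simpa using Nat.mod_lt _ hq.pos) this
  · rw [Polynomial.natDegree_sub_C]
    simpa using Polynomial.natDegree_sub_le_of_le (natDegree_digitPoly_le q d a)
      (natDegree_digitPoly_le q d b)

theorem card_filter_polyVal_eq_le {q d a b : ℕ} (hq : q.Prime) (ha : a < q ^ d)
    (hb : b < q ^ d) (hab : a ≠ b) :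
    ((Finset.range q).filter fun x => polyVal q d a x = polyVal q d b x).card ≤ d + 1 := by
  simpa using card_filter_polyVal_add_eq_le hq ha hb hab 0 0

theorem Nat.pair_lt_sq {a b N : ℕ} (ha : a < N) (hb : b < N) : Nat.pair a b < N ^ 2 :=
  (Nat.pair_lt_max_add_one_sq a b).trans_le (Nat.pow_le_pow_left (by omega) 2)

theorem Nat.unpair_lt_of_lt_sq {c N : ℕ} (hc : c < N ^ 2) :
    (Nat.unpair c).1 < N ∧ (Nat.unpair c).2 < N := by
  have h := Nat.max_sq_add_min_le_pair (Nat.unpair c).1 (Nat.unpair c).2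
  rw [Nat.pair_unpair] at h
  have : max (Nat.unpair c).1 (Nat.unpair c).2 < N := by
    by_contra! h'
    have := Nat.pow_le_pow_left h' 2
    omega
  exact ⟨by omega, by omega⟩

/-! ### Synchronous algorithms as locally-iterative rules -/

/-- The memory of a vertex while it has no final colour to announce; all of it is broadcast. -/
structure State where
  /-- a proper colouring: first the identifier, later the result of Linial's reduction -/
  psi : ℕ
  /-- the time at which the vertex joined its class -/
  t : ℕ
  /-- the shift of the polynomial of the vertex -/
  r : ℕ
  /-- the final colour, if already chosen -/
  col : Option ℕ

namespace State

/-- The content of a memory as one number; `0` in the last place stands for a missing colour. -/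
def encode (s : State) : ℕ :=
  Nat.pair s.psi (Nat.pair s.t (Nat.pair s.r (s.col.elim 0 Nat.succ)))

/-- Left inverse of `State.encode`. -/
def decode (c : ℕ) : State where
  psi := c.unpair.1
  t := c.unpair.2.unpair.1
  r := c.unpair.2.unpair.2.unpair.1
  col := if c.unpair.2.unpair.2.unpair.2 = 0 then none
    else some (c.unpair.2.unpair.2.unpair.2 - 1)

@[simp]
theorem decode_encode (s : State) : decode s.encode = s := by
  obtain ⟨psi, t, r, col⟩ := s
  cases col <;> simp [encode, decode]

/-- All entries of the memory are less than `B`, a colour `c` being counted as `c + 1`, as in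
`State.encode`. -/
structure BoundedBy (B : ℕ) (s : State) : Prop where
  psi_lt : s.psi < B
  t_lt : s.t < B
  r_lt : s.r < B
  col_lt : ∀ c, s.col = some c → c + 1 < B

theorem BoundedBy.encode_lt {B : ℕ} {s : State} (h : s.BoundedBy B) : s.encode < B ^ 8 := by
  have hc : s.col.elim 0 Nat.succ < B := by
    cases hs : s.col with
    | none => exact (Nat.zero_le _).trans_lt h.psi_lt
    | some c => exact h.col_lt c hs
  have hB : 0 < B := (Nat.zero_le _).trans_lt h.psi_lt
  have h1 := Nat.pair_lt_sq h.r_lt hc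
  have h2 := Nat.pair_lt_sq (h.t_lt.trans_le (Nat.le_self_pow two_ne_zero B)) h1
  have h3 := Nat.pair_lt_sq
    (h.psi_lt.trans_le ((Nat.le_self_pow two_ne_zero B).trans (Nat.le_self_pow two_ne_zero _))) h2
  calc s.encode < ((B ^ 2) ^ 2) ^ 2 := h3
    _ = B ^ 8 := by ring

end State

/-- A step of a synchronous algorithm: the new memory of a vertex, from its own memory and those
of its neighbours. -/
abbrev Round := State → Multiset State → State

section Run

variable {V : Type*} [Fintype V] (G : SimpleGraph V) [DecidableRel G.Adj]

/-- The memories of the neighbours of `v`. -/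
def neighborStates (s : V → State) (v : V) : Multiset State := (G.neighborFinset v).val.map s

@[simp]
theorem mem_neighborStates {s : V → State} {v : V} {x : State} :
    x ∈ neighborStates G s v ↔ ∃ u, G.Adj v u ∧ s u = x := by
  simp [neighborStates]

theorem countP_neighborStates (s : V → State) (v : V) (p : State → Prop) [DecidablePred p] :
    (neighborStates G s v).countP p = ((G.neighborFinset v).filter fun u => p (s u)).card := by
  rw [neighborStates, Multiset.countP_map]
  rfl

/-- The memories of all vertices after the rounds of the list `P`, executed in this order. -/
def run (P : List Round) (s : V → State) : V → State :=
  P.foldl (fun s f v => f (s v) (neighborStates G s v)) s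

theorem run_singleton (f : Round) (s : V → State) (v : V) :
    run G [f] s v = f (s v) (neighborStates G s v) := rfl

theorem run_cons (f : Round) (P : List Round) (s : V → State) :
    run G (f :: P) s = run G P (run G [f] s) := rfl

theorem run_append (P Q : List Round) (s : V → State) :
    run G (P ++ Q) s = run G Q (run G P s) := by
  simp [run]

/-- An invariant of every single round of `P` is an invariant of `P`. -/
theorem run_induction {P : List Round} {I : (V → State) → Prop} {s : V → State}
    (hI : I s) (h : ∀ f ∈ P, ∀ s, I s → I (run G [f] s)) : I (run G P s) := by
  induction P generalizing s with
  | nil => exact hI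
  | cons f P ih =>
    rw [run_cons]
    exact ih (h f (by simp) s hI) fun g hg => h g (by simp [hg])

end Run

/-- The locally-iterative rule that executes the rounds `P`. A colour less than `Δ + 1` is final.
Every other colour is `Δ + 1 + Nat.pair k m` where `k` is the number of rounds done and `m`
encodes the memory, so that all vertices know which round is next. After the last round each
vertex shows the colour in its memory. -/
def ruleOfRounds (Δ : ℕ) (P : List Round) : LocallyIterativeRule where
  init i := Δ + 1 + Nat.pair 0 (State.encode ⟨i, 0, 0, none⟩)
  update c M :=
    if c < Δ + 1 then c
    else
      let k := (c - (Δ + 1)).unpair.1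
      let s := P.getD k (fun s _ => s) (State.decode (c - (Δ + 1)).unpair.2)
        (M.map fun c' => State.decode (c' - (Δ + 1)).unpair.2)
      if k + 1 = P.length then s.col.getD 0 else Δ + 1 + Nat.pair (k + 1) s.encode

section Rule

variable {V : Type*} [Fintype V] (G : SimpleGraph V) [DecidableRel G.Adj]

theorem color_ruleOfRounds_of_lt {Δ : ℕ} {P : List Round} (ident : V → ℕ) (t : ℕ)
    (ht : t < P.length) (v : V) :
    (ruleOfRounds Δ P).color G ident t v =
      Δ + 1 + Nat.pair t (run G (P.take t) (fun v => ⟨ident v, 0, 0, none⟩) v).encode := by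
  induction t generalizing v with
  | zero => rfl
  | succ t ih =>
    have ih := ih (by omega)
    rw [LocallyIterativeRule.color, funext ih]
    rw [List.take_succ_eq_append_getElem (by omega), run_append, run_singleton, neighborStates]
    simp only [ruleOfRounds, Multiset.map_map, Function.comp_def, Nat.unpair_pair,
      Nat.add_sub_cancel_left, State.decode_encode]
    rw [if_neg (by omega), if_neg (by omega), List.getD_eq_getElem _ _ (by omega)]

theorem color_ruleOfRounds_of_ge {Δ : ℕ} {P : List Round} (hP : P ≠ []) (ident : V → ℕ)
    {φ : V → ℕ}
    (h : ∀ v, (run G P (fun v => ⟨ident v, 0, 0, none⟩) v).col = some (φ v)) (hφ : ∀ v, φ v ≤ Δ)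
    (t : ℕ) (ht : P.length ≤ t) (v : V) : (ruleOfRounds Δ P).color G ident t v = φ v := by
  induction t, ht using Nat.le_induction generalizing v with
  | base =>
    obtain ⟨l, hl⟩ : ∃ l, P.length = l + 1 := ⟨P.length - 1, by
      have := List.length_pos_iff.2 hP; omega⟩
    rw [hl, LocallyIterativeRule.color,
      funext (color_ruleOfRounds_of_lt G ident l (by omega))]
    have h := h v
    rw [← List.take_length (l := P), hl, List.take_succ_eq_append_getElem (by omega), run_append,
      run_singleton, neighborStates] at h
    simp only [ruleOfRounds, Multiset.map_map, Function.comp_def, Nat.unpair_pair,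
      Nat.add_sub_cancel_left, State.decode_encode]
    rw [if_neg (by omega), if_pos hl.symm, List.getD_eq_getElem _ _ (by omega), h]
    rfl
  | succ t ht ih =>
    rw [LocallyIterativeRule.color, ih]
    exact if_pos (by have := hφ v; omega)

end Rule

/-! ### Linial's colour reduction -/

/-- The least prime number greater than `N`. -/
noncomputable def primeAbove (N : ℕ) : ℕ := Nat.find (Nat.exists_infinite_primes (N + 1))

theorem prime_primeAbove (N : ℕ) : (primeAbove N).Prime :=
  (Nat.find_spec (Nat.exists_infinite_primes (N + 1))).2

theorem lt_primeAbove (N : ℕ) : N < primeAbove N :=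
  (Nat.find_spec (Nat.exists_infinite_primes (N + 1))).1

theorem primeAbove_le {N : ℕ} (hN : N ≠ 0) : primeAbove N ≤ 2 * N := by
  obtain ⟨p, hp, h1, h2⟩ := Nat.exists_prime_lt_and_le_two_mul N hN
  exact (Nat.find_min' _ ⟨h1, hp⟩).trans h2

/-- If each of the constraints in `T` excludes at most `k` elements of `S`, and `S` is large
enough, then some element of `S` meets all constraints. -/
theorem exists_mem_forall_not {α ι : Type*} {S : Finset α} {T : Finset ι}
    {bad : ι → α → Prop} [∀ i, DecidablePred (bad i)] {k : ℕ}
    (hbad : ∀ i ∈ T, (S.filter (bad i)).card ≤ k) (h : T.card * k < S.card) :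
    ∃ x ∈ S, ∀ i ∈ T, ¬ bad i x := by
  classical
  have h1 : (T.biUnion fun i => S.filter (bad i)).card ≤ T.card * k :=
    Finset.card_biUnion_le_card_mul _ _ _ hbad
  obtain ⟨x, hx, hx'⟩ := Finset.exists_mem_notMem_of_card_lt_card (h1.trans_lt h)
  refine ⟨x, hx, fun i hi hb => hx' ?_⟩
  exact Finset.mem_biUnion.2 ⟨i, hi, Finset.mem_filter.2 ⟨hx, hb⟩⟩

open Classical in
/-- Linial's colour reduction: `v` looks for a point `x` in which its polynomial differs from
those of all neighbours, and takes the point `(x, value at x)` of its graph as new colour. -/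
noncomputable def linialRound (q d : ℕ) : Round := fun s M =>
  if h : ∃ x < q, ∀ s' ∈ M, polyVal q d s.psi x ≠ polyVal q d s'.psi x then
    { s with psi := Nat.pair h.choose (polyVal q d s.psi h.choose).val }
  else s

section Linial

variable {V : Type*} [Fintype V] (G : SimpleGraph V) [DecidableRel G.Adj]

theorem linialRound_spec {q d m : ℕ} (hq : q.Prime) (hdeg : G.maxDegree * (d + 1) < q)
    (hm : m ≤ q ^ d) {s : V → State} (hs : IsProperColoring G fun v => (s v).psi)
    (hsm : ∀ v, (s v).psi < m) :
    IsProperColoring G (fun v => (run G [linialRound q d] s v).psi) ∧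
      ∀ v, (run G [linialRound q d] s v).psi < q ^ 2 := by
  classical
  have := Fact.mk hq
  have key : ∀ v, ∃ x < q, (∀ u, G.Adj v u → polyVal q d (s v).psi x ≠ polyVal q d (s u).psi x) ∧
      (run G [linialRound q d] s v).psi = Nat.pair x (polyVal q d (s v).psi x).val := by
    intro v
    have h : ∃ x < q, ∀ s' ∈ neighborStates G s v,
        polyVal q d (s v).psi x ≠ polyVal q d s'.psi x := by
      obtain ⟨x, hx, h⟩ := exists_mem_forall_not (S := Finset.range q) (T := G.neighborFinset v)
        (bad := fun u x => polyVal q d (s v).psi x = polyVal q d (s u).psi x) (k := d + 1)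
        (fun u hu => card_filter_polyVal_eq_le hq ((hsm v).trans_le hm) ((hsm u).trans_le hm)
          (hs v u ((G.mem_neighborFinset v u).1 hu)))
        (by
          rw [G.card_neighborFinset_eq_degree, Finset.card_range]
          exact (Nat.mul_le_mul_right _ (G.degree_le_maxDegree v)).trans_lt hdeg)
      refine ⟨x, Finset.mem_range.1 hx, fun s' hs' => ?_⟩
      obtain ⟨u, hu, rfl⟩ := (mem_neighborStates G).1 hs'
      exact h u ((G.mem_neighborFinset v u).2 hu)
    refine ⟨h.choose, h.choose_spec.1, fun u hu => h.choose_spec.2 _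
      ((mem_neighborStates G).2 ⟨u, hu, rfl⟩), ?_⟩
    rw [run_singleton, linialRound, dif_pos h]
  constructor
  · intro u v huv heq
    obtain ⟨x, -, hxu, hu⟩ := key u
    obtain ⟨y, -, -, hv⟩ := key v
    simp only [hu, hv, Nat.pair_eq_pair] at heq
    obtain ⟨rfl, heq⟩ := heq
    exact hxu v huv (ZMod.val_injective q heq)
  · intro v
    obtain ⟨x, hx, -, hv⟩ := key v
    rw [hv]
    exact Nat.pair_lt_sq hx (ZMod.val_lt _)

/-- The number of colours left after `k` rounds of Linial's reduction from `n` colours. With `m`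
colours, polynomials with `m.size` free coefficients are used, over a field with more than `Δ *
(m.size + 1)` elements. -/
noncomputable def linialCount (Δ n : ℕ) : ℕ → ℕ
  | 0 => n
  | k + 1 => primeAbove (Δ * ((linialCount Δ n k).size + 1)) ^ 2

/-- The first `k` rounds of Linial's reduction from `n` colours. -/
noncomputable def linialRounds (Δ n k : ℕ) : List Round :=
  (List.range k).map fun i =>
    linialRound (primeAbove (Δ * ((linialCount Δ n i).size + 1))) (linialCount Δ n i).size

theorem linialRounds_succ (Δ n k : ℕ) : linialRounds Δ n (k + 1) = linialRounds Δ n k ++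
    [linialRound (primeAbove (Δ * ((linialCount Δ n k).size + 1))) (linialCount Δ n k).size] := by
  simp [linialRounds, List.range_succ]

theorem linialRounds_spec {n : ℕ} {s : V → State} (hs : IsProperColoring G fun v => (s v).psi)
    (hsn : ∀ v, (s v).psi < n) (k : ℕ) :
    IsProperColoring G (fun v => (run G (linialRounds G.maxDegree n k) s v).psi) ∧
      ∀ v, (run G (linialRounds G.maxDegree n k) s v).psi < linialCount G.maxDegree n k := by
  induction k with
  | zero => exact ⟨hs, hsn⟩
  | succ k ih =>
    rw [linialRounds_succ, run_append]
    refine linialRound_spec G (prime_primeAbove _) (lt_primeAbove _) ?_ ih.1 ih.2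
    exact (Nat.lt_size_self _).le.trans
      (Nat.pow_le_pow_left (prime_primeAbove _).two_le _)

end Linial

theorem linialRound_apply (q d : ℕ) (s : State) (M : Multiset State) :
    linialRound q d s M = s ∨ ∃ x < q,
      linialRound q d s M = { s with psi := Nat.pair x (polyVal q d s.psi x).val } := by
  unfold linialRound
  split_ifs with h
  · exact Or.inr ⟨_, h.choose_spec.1, rfl⟩
  · exact Or.inl rfl

theorem logStar_ne_zero {n : ℕ} (hn : 2 ≤ n) : logStar n ≠ 0 := by
  intro h0
  have h := logStar_spec n
  rw [h0, Function.iterate_zero, id_eq] at h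
  have : n ≤ 1 := by exact_mod_cast h
  omega

theorem iterate_logb_gt_one {n k : ℕ} (hk : k < logStar n) : 1 < (Real.logb 2)^[k] (n : ℝ) :=
  not_le.1 fun h => Nat.notMem_of_lt_sInf hk h

theorem iterate_logb_le {n k : ℕ} (hk : k < logStar n) : (Real.logb 2)^[k] (n : ℝ) ≤ n := by
  induction k with
  | zero => exact le_rfl
  | succ k ih =>
    have h1 := iterate_logb_gt_one (n := n) (k := k) (by omega)
    refine le_trans ?_ (ih (by omega))
    rw [Function.iterate_succ_apply', Real.logb_le_iff_le_rpow (by norm_num) (by linarith)]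
    have := one_add_mul_self_le_rpow_one_add (s := 1) (by norm_num) h1.le
    norm_num at this
    linarith

theorem size_le_logb_add_one {m : ℕ} (hm : m ≠ 0) : (m.size : ℝ) ≤ Real.logb 2 m + 1 := by
  have h : 0 < m.size := Nat.size_pos.2 (Nat.pos_of_ne_zero hm)
  have h1 : 2 ^ (m.size - 1) ≤ m := Nat.lt_size.1 (by omega)
  have h2 : ((m.size - 1 : ℕ) : ℝ) ≤ Real.logb 2 m := by
    rw [Real.le_logb_iff_rpow_le (by norm_num) (by exact_mod_cast Nat.pos_of_ne_zero hm),
      Real.rpow_natCast]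
    exact_mod_cast h1
  rw [Nat.cast_sub h] at h2
  push_cast at h2
  linarith

theorem linialCount_ne_zero {Δ n : ℕ} (hn : n ≠ 0) (k : ℕ) : linialCount Δ n k ≠ 0 := by
  cases k with
  | zero => exact hn
  | succ k => exact pow_ne_zero _ (prime_primeAbove _).ne_zero

/-- As long as the iterated logarithms `L` of `n` exceed `1`, Linial's reduction keeps pace with
them up to a factor that depends on `Δ` only: with `w = 16 * (Δ + 1)` and `m ≤ w ^ 4 * L ^ 2`
colours, the next prime is at most `2 * Δ * (m.size + 1) ≤ w ^ 2 * log L`. Hence the coefficient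
`1` of `log* n` in the running time. -/
theorem linialCount_le {Δ n k : ℕ} (hΔ : Δ ≠ 0) (hn : n ≠ 0) (hk : k < logStar n) :
    (linialCount Δ n k : ℝ) ≤ (16 * (Δ + 1)) ^ 4 * ((Real.logb 2)^[k] (n : ℝ)) ^ 2 := by
  induction k with
  | zero =>
    have h1 : (1 : ℝ) ≤ n := by exact_mod_cast Nat.pos_of_ne_zero hn
    have h2 : (1 : ℝ) ≤ (16 * ((Δ : ℝ) + 1)) ^ 4 := by
      refine one_le_pow₀ ?_
      have : (0 : ℝ) ≤ Δ := Nat.cast_nonneg _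
      linarith
    simp only [linialCount, Function.iterate_zero, id_eq]
    nlinarith [mul_le_mul h2 (show (n : ℝ) ≤ n ^ 2 by nlinarith) (by positivity) (by positivity)]
  | succ k ih =>
    have ih := ih (by omega)
    have hL := iterate_logb_gt_one (n := n) (k := k) (by omega)
    have hL' := iterate_logb_gt_one hk
    set L := (Real.logb 2)^[k] (n : ℝ) with hLdef
    set L' := (Real.logb 2)^[k + 1] (n : ℝ) with hLdef'
    have hLL : L' = Real.logb 2 L := by rw [hLdef', Function.iterate_succ_apply']
    set m := linialCount Δ n k with hm
    have hm0 : m ≠ 0 := linialCount_ne_zero hn k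
    have hm0' : (0 : ℝ) < m := by exact_mod_cast Nat.pos_of_ne_zero hm0
    have hΔ0 : (0 : ℝ) ≤ Δ := Nat.cast_nonneg _
    obtain ⟨w, hw⟩ : ∃ w : ℝ, w = 16 * (Δ + 1) := ⟨_, rfl⟩
    rw [← hw] at ih ⊢
    have hw16 : 16 ≤ w := by linarith
    have hlogw : Real.logb 2 w ≤ w - 1 := by
      rw [Real.logb_le_iff_le_rpow (by norm_num) (by linarith)]
      have := one_add_mul_self_le_rpow_one_add (s := 1) (p := w - 1) (by norm_num) (by linarith)
      norm_num at this
      linarith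
    have hlogm : Real.logb 2 m ≤ 4 * (w - 1) + 2 * L' := by
      calc Real.logb 2 m ≤ Real.logb 2 (w ^ 4 * L ^ 2) :=
            Real.logb_le_logb_of_le (by norm_num) hm0' ih
        _ = 4 * Real.logb 2 w + 2 * L' := by
            rw [Real.logb_mul (by positivity) (by positivity), Real.logb_pow, Real.logb_pow, hLL]
            norm_num
        _ ≤ _ := by linarith
    -- Here `1 < L'` is used to absorb the summand `4 * (w - 1) + 2` into a multiple of `L'`.
    have hsize : (m.size : ℝ) + 1 ≤ 4 * w * L' := by
      have := size_le_logb_add_one hm0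
      nlinarith
    have hprime : (primeAbove (Δ * (m.size + 1)) : ℝ) ≤ 2 * (Δ * (m.size + 1)) := by
      exact_mod_cast primeAbove_le (mul_ne_zero hΔ (Nat.succ_ne_zero _))
    have hstep : (primeAbove (Δ * (m.size + 1)) : ℝ) ≤ w ^ 2 * L' := by
      calc _ ≤ 2 * ((Δ : ℝ) * (m.size + 1)) := hprime
        _ ≤ 2 * (w / 16 * (4 * w * L')) := by
            have : (Δ : ℝ) ≤ w / 16 := by linarith
            gcongr
        _ ≤ w ^ 2 * L' := by nlinarith [mul_pos (mul_pos (show 0 < w by linarith)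
            (show 0 < w by linarith)) (show 0 < L' by linarith)]
    simp only [linialCount, ← hm]
    push_cast
    calc _ ≤ (w ^ 2 * L') ^ 2 := by gcongr
      _ = _ := by ring

theorem linialCount_final_le {Δ n : ℕ} (hΔ : Δ ≠ 0) (hn : n ≠ 0) (hs : logStar n ≠ 0) :
    linialCount Δ n (logStar n - 1) ≤ 4 * (16 * (Δ + 1)) ^ 4 := by
  have h1 := linialCount_le hΔ hn (k := logStar n - 1) (by omega)
  have h2 := iterate_logb_gt_one (n := n) (k := logStar n - 1) (by omega)
  have h3 := logStar_spec n
  rw [show logStar n = (logStar n - 1) + 1 by omega, Function.iterate_succ_apply',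
    Real.logb_le_iff_le_rpow (by norm_num) (by linarith), Real.rpow_one] at h3
  have : (linialCount Δ n (logStar n - 1) : ℝ) ≤ 4 * (16 * (Δ + 1)) ^ 4 := by
    refine h1.trans ?_
    rw [mul_comm]
    gcongr
    nlinarith
  exact_mod_cast this

/-! ### Distributing the vertices to classes of small out-degree -/

/-- Marks all vertices as not having joined a class: class members have a time less than `q`. -/
def resetRound (q : ℕ) : Round := fun s _ => { s with t := q }

open Classical in
/-- In round `i` a vertex that is still without class tries the value of its polynomial at `i`. An
uncoloured neighbour conflicts if it tries the same value now or has joined that class earlier;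
both cases are caught by evaluating its polynomial at `min t i`, as `t = q` for vertices without
class. With at most `β` conflicts the vertex joins the class, and stores only the time `i`: its
class is the value of its polynomial at that time. -/
noncomputable def trialRound (q d β i : ℕ) : Round := fun s M =>
  if s.col = none ∧ s.t = q ∧ M.countP (fun s' => s'.col = none ∧
      polyVal q d s'.psi (min s'.t i) = polyVal q d s.psi i) ≤ β then
    { s with t := i }
  else s

/-- The first `k` rounds of the distribution of the uncoloured vertices to `q` classes. -/
noncomputable def trialRounds (q d β k : ℕ) : List Round :=
  resetRound q :: (List.range k).map (trialRound q d β)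

theorem trialRounds_succ (q d β k : ℕ) :
    trialRounds q d β (k + 1) = trialRounds q d β k ++ [trialRound q d β k] := by
  simp [trialRounds, List.range_succ]

theorem trialRound_apply (q d β i : ℕ) (s : State) (M : Multiset State) :
    trialRound q d β i s M = s ∨ trialRound q d β i s M = { s with t := i } := by
  unfold trialRound
  split_ifs
  · exact Or.inr rfl
  · exact Or.inl rfl

section Trial

variable {V : Type*} [Fintype V] (G : SimpleGraph V) [DecidableRel G.Adj]

theorem run_trialRounds_eq (q d β k : ℕ) (s : V → State) (v : V) :
    run G (trialRounds q d β k) s v =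
      { s v with t := (run G (trialRounds q d β k) s v).t } := by
  induction k with
  | zero => rfl
  | succ k ih =>
    rw [trialRounds_succ, run_append, run_singleton]
    rcases trialRound_apply q d β k (run G (trialRounds q d β k) s v)
      (neighborStates G (run G (trialRounds q d β k) s) v) with h | h
    · rw [h]; exact ih
    · rw [h, ih]

open Classical in
/-- The rule by which the times develop, with the unchanging entries read off the initial
memories. -/
theorem run_trialRounds_succ_t (q d β k : ℕ) (s : V → State) (v : V) :
    (run G (trialRounds q d β (k + 1)) s v).t =
      if (s v).col = none ∧ (run G (trialRounds q d β k) s v).t = q ∧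
          ((G.neighborFinset v).filter fun u => (s u).col = none ∧
            polyVal q d (s u).psi (min (run G (trialRounds q d β k) s u).t k) =
              polyVal q d (s v).psi k).card ≤ β
      then k else (run G (trialRounds q d β k) s v).t := by
  rw [trialRounds_succ, run_append, run_singleton, trialRound, countP_neighborStates]
  have hcol : ∀ u, (run G (trialRounds q d β k) s u).col = (s u).col := fun u => by
    rw [run_trialRounds_eq]
  have hpsi : ∀ u, (run G (trialRounds q d β k) s u).psi = (s u).psi := fun u => by
    rw [run_trialRounds_eq]
  simp only [hcol, hpsi]
  split_ifs <;> rfl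

theorem run_trialRounds_t (q d β k : ℕ) (s : V → State) (v : V) :
    (run G (trialRounds q d β k) s v).t = q ∨ (run G (trialRounds q d β k) s v).t < k := by
  induction k with
  | zero => exact Or.inl rfl
  | succ k ih =>
    rw [run_trialRounds_succ_t]
    split_ifs <;> omega

open Classical in
theorem trial_outdegree_le {q d β k : ℕ} (hk : k ≤ q) (s : V → State) (v : V)
    (hv : (run G (trialRounds q d β k) s v).t < q) :
    ((G.neighborFinset v).filter fun u => (s u).col = none ∧
      polyVal q d (s u).psi (run G (trialRounds q d β k) s u).t =
        polyVal q d (s v).psi (run G (trialRounds q d β k) s v).t ∧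
      (run G (trialRounds q d β k) s u).t ≤ (run G (trialRounds q d β k) s v).t).card ≤ β := by
  induction k with
  | zero => exact absurd hv (lt_irrefl q)
  | succ k ih =>
    have ih := ih (by omega)
    have ht := fun u => run_trialRounds_t G q d β k s u
    have hsucc := fun u => run_trialRounds_succ_t G q d β k s u
    -- In round `k` the time of a vertex either stays or changes from `q` to `k`.
    have hstep : ∀ u, (run G (trialRounds q d β (k + 1)) s u).t =
          (run G (trialRounds q d β k) s u).t ∨
        (run G (trialRounds q d β (k + 1)) s u).t = k ∧
          (run G (trialRounds q d β k) s u).t = q := by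
      intro u
      rw [hsucc u]
      split_ifs with h
      · exact Or.inr ⟨rfl, h.2.1⟩
      · exact Or.inl rfl
    rcases hstep v with h | h
    -- An old member of a class gets no new out-neighbours: whoever joins now has a later time.
    · refine le_trans (Finset.card_le_card ?_) (ih (by omega))
      intro u hu
      obtain ⟨hu, hcol, hval, hle⟩ := Finset.mem_filter.1 hu
      refine Finset.mem_filter.2 ⟨hu, hcol, ?_⟩
      have hu' : (run G (trialRounds q d β (k + 1)) s u).t =
          (run G (trialRounds q d β k) s u).t := by
        have := hstep u
        have := ht v
        omega
      rw [← hu', ← h]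
      exact ⟨hval, hle⟩
    · have hc := hsucc v
      split_ifs at hc with h'
      · refine le_trans (Finset.card_le_card ?_) h'.2.2
        intro u hu
        obtain ⟨hu, hcol, hval, hle⟩ := Finset.mem_filter.1 hu
        refine Finset.mem_filter.2 ⟨hu, hcol, ?_⟩
        have hu' : min (run G (trialRounds q d β k) s u).t k =
            (run G (trialRounds q d β (k + 1)) s u).t := by
          have := hstep u
          omega
        rw [hu', hval, hc]
      · omega

open Classical in
/-- Every uncoloured vertex joins a class within `q` rounds. Each failure costs at least `β + 1`
conflicts, but a neighbour causes at most `d + 1` conflicts before it joins a class (its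
polynomial meets that of `v`) and at most `d + 1` afterwards (the polynomial of `v` meets a
constant). -/
theorem trial_lt {q d β : ℕ} (hq : q.Prime) {s : V → State}
    (hs : IsProperColoring G fun v => (s v).psi) (hsq : ∀ v, (s v).psi < q ^ d) {v : V}
    (hv : (s v).col = none)
    (hdeg : ((G.neighborFinset v).filter fun u => (s u).col = none).card * (2 * (d + 1)) <
      q * (β + 1)) :
    (run G (trialRounds q d β q) s v).t < q := by
  by_contra hcon
  have hcon' := run_trialRounds_t G q d β q s v
  set N := (G.neighborFinset v).filter fun u => (s u).col = none with hN
  -- `act` counts the conflicts with `u` before `u` joins a class, and `fin` (an upper bound for)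
  -- those afterwards.
  let act : ℕ → V → ℕ := fun k u =>
    ((Finset.range k).filter fun i => polyVal q d (s v).psi i = polyVal q d (s u).psi i).card
  let fin : ℕ → V → ℕ := fun k u => if (run G (trialRounds q d β k) s u).t < q then
    ((Finset.range k).filter fun i => polyVal q d (s v).psi i =
      polyVal q d (s u).psi (run G (trialRounds q d β k) s u).t).card else 0
  have key : ∀ k ≤ q, (run G (trialRounds q d β k) s v).t = q →
      k * (β + 1) ≤ ∑ u ∈ N, (act k u + fin k u) := by
    intro k
    induction k with
    | zero => simp
    | succ k ih =>
      intro hkq hkv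
      have hc := run_trialRounds_succ_t G q d β k s v
      rw [hkv] at hc
      split_ifs at hc with hif
      · omega
      have ih := ih (by omega) hc.symm
      simp only [hv, ← hc, true_and, not_le] at hif
      rw [← Finset.filter_filter, ← hN] at hif
      have hsum : ∑ u ∈ N, (if polyVal q d (s u).psi (min (run G (trialRounds q d β k) s u).t k) =
          polyVal q d (s v).psi k then 1 else 0) + ∑ u ∈ N, (act k u + fin k u) ≤
          ∑ u ∈ N, (act (k + 1) u + fin (k + 1) u) := by
        rw [← Finset.sum_add_distrib]
        refine Finset.sum_le_sum fun u _ => ?_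
        have hu := run_trialRounds_t G q d β k s u
        have hsu := run_trialRounds_succ_t G q d β k s u
        have hact : act (k + 1) u = (if polyVal q d (s v).psi k = polyVal q d (s u).psi k
            then 1 else 0) + act k u := by
          simp only [act, Finset.range_add_one, Finset.filter_insert]
          split_ifs
          · rw [Finset.card_insert_of_notMem (by simp), add_comm]
          · simp
        by_cases hlt : (run G (trialRounds q d β k) s u).t < q
        · have hne : (run G (trialRounds q d β k) s u).t ≠ q := hlt.ne
          simp only [hne, false_and, and_false, if_false] at hsu
          have hfin : fin (k + 1) u = (if polyVal q d (s v).psi k =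
              polyVal q d (s u).psi (run G (trialRounds q d β k) s u).t
              then 1 else 0) + fin k u := by
            simp only [fin, hsu, if_pos hlt, Finset.range_add_one, Finset.filter_insert]
            split_ifs
            · rw [Finset.card_insert_of_notMem (by simp), add_comm]
            · simp
          rw [hact, hfin, min_eq_left (by omega)]
          simp only [eq_comm (a := polyVal q d (s v).psi k)]
          omega
        · have hfin : fin k u = 0 := if_neg hlt
          rw [hact, hfin, min_eq_right (by omega)]
          simp only [eq_comm (a := polyVal q d (s v).psi k)]
          omega
      rw [Finset.sum_boole] at hsum
      simp only [Nat.cast_id] at hsum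
      calc (k + 1) * (β + 1) = (β + 1) + k * (β + 1) := by ring
        _ ≤ _ := by omega
  have h1 := key q le_rfl (by omega)
  have h2 : ∑ u ∈ N, (act q u + fin q u) ≤ ∑ _u ∈ N, 2 * (d + 1) := by
    refine Finset.sum_le_sum fun u hu => ?_
    have hadj : G.Adj v u := (G.mem_neighborFinset v u).1 (Finset.mem_filter.1 hu).1
    have ha : act q u ≤ d + 1 := card_filter_polyVal_eq_le hq (hsq v) (hsq u) (hs v u hadj)
    have hf : fin q u ≤ d + 1 := by
      simp only [fin]
      split_ifs
      · exact card_filter_polyVal_eq_const_le hq d _ _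
      · omega
    omega
  rw [Finset.sum_const, smul_eq_mul] at h2
  omega

end Trial

/-! ### Colouring the classes -/

open Classical in
/-- The colours in `{0, …, Δ}` that no neighbour has. -/
noncomputable def freeColors (Δ : ℕ) (M : Multiset State) : Finset ℕ :=
  (Finset.range (Δ + 1)).filter fun c => ∀ s ∈ M, s.col ≠ some c

/-- The points `x` in which the polynomial of `a`, shifted by `r`, gives a colour of `L`; the
point `(x, y)` of the plane over `ZMod p` is identified with the colour `Nat.pair x y`. -/
noncomputable def goodPositions (p d : ℕ) (L : Finset ℕ) (a r : ℕ) : Finset ℕ :=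
  (Finset.range p).filter fun x => Nat.pair x (polyVal p d a x + r).val ∈ L

theorem exists_shift {p d : ℕ} (hp : p.Prime) (a : ℕ) {L : Finset ℕ} (hL : ∀ c ∈ L, c < p ^ 2) :
    ∃ r < p, L.card ≤ p * (goodPositions p d L a r).card := by
  have := Fact.mk hp
  -- Each colour `(x, y)` lies on the graph for exactly one shift, so the average over all shifts
  -- of the number of good points is at least `L.card / p`.
  have h1 : L.card ≤ ∑ r ∈ Finset.range p, (goodPositions p d L a r).card := by
    rw [← Finset.card_sigma]
    refine Finset.card_le_card_of_injOn
      (fun c => ⟨((c.unpair.2 : ZMod p) - polyVal p d a c.unpair.1).val, c.unpair.1⟩) ?_ ?_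
    · intro c hc
      obtain ⟨hx, hy⟩ := Nat.unpair_lt_of_lt_sq (hL c hc)
      have hc' : Nat.pair c.unpair.1 c.unpair.2 ∈ L := by rw [Nat.pair_unpair]; exact hc
      simp only [Finset.coe_sigma, Set.mem_sigma_iff, Finset.mem_coe, Finset.mem_range,
        goodPositions, Finset.mem_filter]
      refine ⟨ZMod.val_lt _, hx, ?_⟩
      rw [ZMod.natCast_zmod_val, add_sub_cancel, ZMod.val_cast_of_lt hy]
      exact hc'
    · intro c hc c' hc' h
      obtain ⟨hx, hy⟩ := Nat.unpair_lt_of_lt_sq (hL c hc)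
      obtain ⟨hx', hy'⟩ := Nat.unpair_lt_of_lt_sq (hL c' hc')
      simp only [Sigma.mk.injEq, heq_eq_eq] at h
      obtain ⟨h1, h2⟩ := h
      rw [h2] at h1
      have h3 := sub_left_injective (ZMod.val_injective p h1)
      have h4 := natCast_zmod_injOn p (by simpa using hy) (by simpa using hy') h3
      rw [← Nat.pair_unpair c, ← Nat.pair_unpair c', h2, h4]
  obtain ⟨r, hr, h⟩ := Finset.exists_le_of_sum_le (s := Finset.range p) (f := fun _ => L.card)
    (g := fun r => p * (goodPositions p d L a r).card) ⟨0, by simpa using hp.pos⟩ (by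
      rw [← Finset.mul_sum, Finset.sum_const, Finset.card_range, smul_eq_mul]
      exact Nat.mul_le_mul_left p h1)
  exact ⟨r, Finset.mem_range.1 hr, h⟩

open Classical in
/-- Every vertex chooses a shift for which at least the average number of points of its shifted
polynomial are free colours. -/
noncomputable def shiftRound (Δ p d : ℕ) : Round := fun s M =>
  if h : ∃ r < p, (freeColors Δ M).card ≤
      p * (goodPositions p d (freeColors Δ M) s.psi r).card then
    { s with r := h.choose }
  else s

open Classical in
/-- The uncoloured vertices of class `c` look for a free colour on the graph of their shifted
polynomials that avoids the shifted polynomials of all out-neighbours, which are the uncoloured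
neighbours of the same class that joined it no later. -/
noncomputable def classRound (Δ q p d c : ℕ) : Round := fun s M =>
  if h : s.col = none ∧ (polyVal q d s.psi s.t).val = c ∧
      ∃ x ∈ goodPositions p d (freeColors Δ M) s.psi s.r, ∀ s' ∈ M, s'.col = none →
        polyVal q d s'.psi s'.t = polyVal q d s.psi s.t → s'.t ≤ s.t →
          polyVal p d s.psi x + s.r ≠ polyVal p d s'.psi x + s'.r then
    { s with col := some (Nat.pair h.2.2.choose (polyVal p d s.psi h.2.2.choose + s.r).val) }
  else s

open Classical in
/-- The uncoloured vertices of class `c` take any free colour. -/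
noncomputable def greedyRound (Δ q d c : ℕ) : Round := fun s M =>
  if h : s.col = none ∧ (polyVal q d s.psi s.t).val = c ∧ (freeColors Δ M).Nonempty then
    { s with col := some h.2.2.choose }
  else s

/-- The memories `s'` arise from `s` by colouring further vertices; only the shifts may change
otherwise. -/
structure Extends {V : Type*} (s s' : V → State) : Prop where
  psi_eq : ∀ v, (s' v).psi = (s v).psi
  t_eq : ∀ v, (s' v).t = (s v).t
  col_eq : ∀ v c, (s v).col = some c → (s' v).col = some c

theorem Extends.refl {V : Type*} (s : V → State) : Extends s s :=
  ⟨fun _ => rfl, fun _ => rfl, fun _ _ => id⟩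

theorem Extends.trans {V : Type*} {s₁ s₂ s₃ : V → State} (h : Extends s₁ s₂) (h' : Extends s₂ s₃) :
    Extends s₁ s₃ :=
  ⟨fun v => (h'.psi_eq v).trans (h.psi_eq v), fun v => (h'.t_eq v).trans (h.t_eq v),
    fun v c hc => h'.col_eq v c (h.col_eq v c hc)⟩

theorem Extends.eq_none {V : Type*} {s s' : V → State} (h : Extends s s') {v : V} (hv : (s' v).col = none) :
    (s v).col = none := by
  cases hc : (s v).col with
  | none => rfl
  | some c => rw [h.col_eq v c hc] at hv; exact absurd hv (by simp)

section Classes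

variable {V : Type*} [Fintype V] (G : SimpleGraph V) [DecidableRel G.Adj]

/-- The colours present lie in `{0, …, Δ}` and differ on adjacent vertices. -/
structure IsPartialColoring (Δ : ℕ) (s : V → State) : Prop where
  col_le : ∀ v c, (s v).col = some c → c ≤ Δ
  proper : ∀ u v, G.Adj u v → ∀ c, (s u).col = some c → (s v).col ≠ some c

theorem mem_freeColors_neighborStates {Δ c : ℕ} {s : V → State} {v : V} :
    c ∈ freeColors Δ (neighborStates G s v) ↔ c ≤ Δ ∧ ∀ u, G.Adj v u → (s u).col ≠ some c := by
  simp [freeColors]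

theorem Extends.freeColors_subset {s s' : V → State} (h : Extends s s') (Δ : ℕ) (v : V) :
    freeColors Δ (neighborStates G s' v) ⊆ freeColors Δ (neighborStates G s v) := by
  intro c hc
  rw [mem_freeColors_neighborStates] at hc ⊢
  exact ⟨hc.1, fun u hu hcol => hc.2 u hu (h.col_eq u c hcol)⟩

open Classical in
/-- There are more free colours than uncoloured neighbours, since each coloured neighbour removes
at most one of the `Δ + 1` colours. -/
theorem card_uncolored_lt_card_freeColors (s : V → State) (v : V) :
    ((G.neighborFinset v).filter fun u => (s u).col = none).card <
      (freeColors G.maxDegree (neighborStates G s v)).card := by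
  set N := G.neighborFinset v with hN
  have h1 : (Finset.range (G.maxDegree + 1)) ⊆ freeColors G.maxDegree (neighborStates G s v) ∪
      (N.filter fun u => ¬ (s u).col = none).image fun u => (s u).col.getD 0 := by
    intro c hc
    by_cases h : ∃ u, G.Adj v u ∧ (s u).col = some c
    · obtain ⟨u, hu, huc⟩ := h
      refine Finset.mem_union_right _ (Finset.mem_image.2 ⟨u, Finset.mem_filter.2
        ⟨(G.mem_neighborFinset v u).2 hu, by simp [huc]⟩, by simp [huc]⟩)
    · refine Finset.mem_union_left _ ((mem_freeColors_neighborStates G).2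
        ⟨Nat.lt_succ_iff.1 (Finset.mem_range.1 hc), fun u hu huc => h ⟨u, hu, huc⟩⟩)
  have h2 := (Finset.card_le_card h1).trans (Finset.card_union_le _ _)
  have h3 := Finset.card_image_le (s := N.filter fun u => ¬ (s u).col = none)
    (f := fun u => (s u).col.getD 0)
  have h4 := Finset.card_filter_add_card_filter_not (s := N) (fun u => (s u).col = none)
  have h5 : N.card ≤ G.maxDegree := by
    rw [hN, G.card_neighborFinset_eq_degree]; exact G.degree_le_maxDegree v
  rw [Finset.card_range] at h2
  omega

/-- A partial colouring stays one when vertices receive free colours, provided that no two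
adjacent vertices receive the same colour in this round. -/
theorem IsPartialColoring.assign {Δ : ℕ} {s s' : V → State} (hs : IsPartialColoring G Δ s)
    (h : ∀ v, s' v = s v ∨ (s v).col = none ∧ ∃ c ∈ freeColors Δ (neighborStates G s v),
      s' v = { s v with col := some c })
    (hnew : ∀ u v, G.Adj u v → (s u).col = none → (s v).col = none → ∀ c,
      (s' u).col = some c → (s' v).col ≠ some c) :
    IsPartialColoring G Δ s' ∧ Extends s s' := by
  refine ⟨⟨fun v c hc => ?_, fun u v huv c hu hv => ?_⟩, ⟨fun v => ?_, fun v => ?_, fun v c hc => ?_⟩⟩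
  · rcases h v with hv | ⟨-, c', hc', hv⟩
    · exact hs.col_le v c (hv ▸ hc)
    · rw [hv] at hc
      obtain rfl : c' = c := by simpa using hc
      exact ((mem_freeColors_neighborStates G).1 hc').1
  · rcases h u with hu' | ⟨hun, c', hc', hu'⟩ <;> rcases h v with hv' | ⟨hvn, c'', hc'', hv'⟩
    · rw [hu'] at hu
      rw [hv'] at hv
      exact hs.proper u v huv c hu hv
    · rw [hu'] at hu
      rw [hv'] at hv
      obtain rfl : c'' = c := by simpa using hv
      exact ((mem_freeColors_neighborStates G).1 hc'').2 u huv.symm hu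
    · rw [hu'] at hu
      rw [hv'] at hv
      obtain rfl : c' = c := by simpa using hu
      exact ((mem_freeColors_neighborStates G).1 hc').2 v huv hv
    · exact hnew u v huv hun hvn c hu hv
  · rcases h v with hv | ⟨-, c', hc', hv⟩ <;> rw [hv]
  · rcases h v with hv | ⟨-, c', hc', hv⟩ <;> rw [hv]
  · rcases h v with hv | ⟨hn, c', hc', hv⟩
    · rw [hv]; exact hc
    · rw [hn] at hc; exact absurd hc (by simp)

theorem classRound_apply (Δ q p d c : ℕ) (s : State) (M : Multiset State) :
    classRound Δ q p d c s M = s ∨ s.col = none ∧ (polyVal q d s.psi s.t).val = c ∧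
      ∃ x ∈ goodPositions p d (freeColors Δ M) s.psi s.r,
        (∀ s' ∈ M, s'.col = none →
          polyVal q d s'.psi s'.t = polyVal q d s.psi s.t → s'.t ≤ s.t →
            polyVal p d s.psi x + s.r ≠ polyVal p d s'.psi x + s'.r) ∧
        classRound Δ q p d c s M =
          { s with col := some (Nat.pair x (polyVal p d s.psi x + s.r).val) } := by
  unfold classRound
  split_ifs with h
  · exact Or.inr ⟨h.1, h.2.1, h.2.2.choose, h.2.2.choose_spec.1, h.2.2.choose_spec.2, rfl⟩
  · exact Or.inl rfl

theorem greedyRound_apply (Δ q d c : ℕ) (s : State) (M : Multiset State) :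
    greedyRound Δ q d c s M = s ∨ s.col = none ∧ (polyVal q d s.psi s.t).val = c ∧
      ∃ x ∈ freeColors Δ M, greedyRound Δ q d c s M = { s with col := some x } := by
  unfold greedyRound
  split_ifs with h
  · exact Or.inr ⟨h.1, h.2.1, h.2.2.choose, h.2.2.choose_spec, rfl⟩
  · exact Or.inl rfl

theorem shiftRound_apply (Δ p d : ℕ) (s : State) (M : Multiset State) :
    shiftRound Δ p d s M = s ∨ ∃ r < p, shiftRound Δ p d s M = { s with r := r } := by
  unfold shiftRound
  split_ifs with h
  · exact Or.inr ⟨h.choose, h.choose_spec.1, rfl⟩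
  · exact Or.inl rfl

theorem classRound_isPartialColoring {Δ q p d c : ℕ} (hq : q.Prime) (hp : p.Prime) {s : V → State}
    (hs : IsPartialColoring G Δ s) :
    IsPartialColoring G Δ (run G [classRound Δ q p d c] s) ∧
      Extends s (run G [classRound Δ q p d c] s) := by
  have := Fact.mk hq
  have := Fact.mk hp
  have happ := fun v => classRound_apply Δ q p d c (s v) (neighborStates G s v)
  refine hs.assign G (fun v => ?_) fun u v huv hu hv e heu hev => ?_
  · rcases happ v with h | ⟨h1, -, x, hx, -, h⟩
    · exact Or.inl h
    · exact Or.inr ⟨h1, _, (Finset.mem_filter.1 hx).2, h⟩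
  · rcases happ u with h | ⟨-, hcu, x, hx, hux, h⟩
    · rw [run_singleton, h, hu] at heu; exact absurd heu (by simp)
    rcases happ v with h' | ⟨-, hcv, y, hy, hvy, h'⟩
    · rw [run_singleton, h', hv] at hev; exact absurd hev (by simp)
    rw [run_singleton, h] at heu
    rw [run_singleton, h'] at hev
    have heq := Option.some.inj (heu.trans hev.symm)
    rw [Nat.pair_eq_pair] at heq
    -- Equal colours have the same first coordinate `x`, so the shifted polynomials of `u` and `v`
    -- agree at `x`; but one of them is an out-neighbour of the other, which has avoided this.
    obtain ⟨rfl, heq⟩ := heq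
    have heq := ZMod.val_injective p heq
    have hcl := ZMod.val_injective q (hcu.trans hcv.symm)
    rcases le_total (s v).t (s u).t with hle | hle
    · exact hux _ ((mem_neighborStates G).2 ⟨v, huv, rfl⟩) hv hcl.symm hle heq
    · exact hvy _ ((mem_neighborStates G).2 ⟨u, huv.symm, rfl⟩) hu hcl hle heq.symm

open Classical in
theorem classRound_colors {Δ q p d c β : ℕ} (hp : p.Prime) {s : V → State}
    (hpsi : IsProperColoring G fun v => (s v).psi) (hpsip : ∀ v, (s v).psi < p ^ d) {v : V}
    (hv : (s v).col = none) (hc : (polyVal q d (s v).psi (s v).t).val = c)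
    (hβ : ((G.neighborFinset v).filter fun u => (s u).col = none ∧
      polyVal q d (s u).psi (s u).t = polyVal q d (s v).psi (s v).t ∧ (s u).t ≤ (s v).t).card ≤ β)
    (hlist : β * (d + 1) <
      (goodPositions p d (freeColors Δ (neighborStates G s v)) (s v).psi (s v).r).card) :
    (run G [classRound Δ q p d c] s v).col ≠ none := by
  obtain ⟨x, hx, hgood⟩ := exists_mem_forall_not
    (S := goodPositions p d (freeColors Δ (neighborStates G s v)) (s v).psi (s v).r)
    (T := (G.neighborFinset v).filter fun u => (s u).col = none ∧
      polyVal q d (s u).psi (s u).t = polyVal q d (s v).psi (s v).t ∧ (s u).t ≤ (s v).t)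
    (bad := fun u x => polyVal p d (s v).psi x + (s v).r = polyVal p d (s u).psi x + (s u).r)
    (k := d + 1)
    (fun u hu => by
      have hadj := (G.mem_neighborFinset v u).1 (Finset.mem_filter.1 hu).1
      refine le_trans (Finset.card_le_card ?_) (card_filter_polyVal_add_eq_le hp (hpsip v)
        (hpsip u) (hpsi v u hadj) (s v).r (s u).r)
      exact Finset.filter_subset_filter _ (Finset.filter_subset _ _))
    ((Nat.mul_le_mul_right _ hβ).trans_lt hlist)
  rw [run_singleton, classRound, dif_pos]
  · simp
  · refine ⟨hv, hc, x, hx, fun s' hs' hcol hcl hle => ?_⟩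
    obtain ⟨u, hu, rfl⟩ := (mem_neighborStates G).1 hs'
    exact hgood u (Finset.mem_filter.2 ⟨(G.mem_neighborFinset v u).2 hu, hcol, hcl, hle⟩)

theorem shiftRound_extends {Δ p d : ℕ} (s : V → State) :
    Extends s (run G [shiftRound Δ p d] s) ∧
      ∀ v, (run G [shiftRound Δ p d] s v).col = (s v).col := by
  have h : ∀ v, ∃ r, run G [shiftRound Δ p d] s v = { s v with r := r } := fun v => by
    rcases shiftRound_apply Δ p d (s v) (neighborStates G s v) with h | ⟨r, -, h⟩
    · exact ⟨(s v).r, h⟩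
    · exact ⟨r, h⟩
  refine ⟨⟨fun v => ?_, fun v => ?_, fun v c hc => ?_⟩, fun v => ?_⟩ <;>
    obtain ⟨r, hr⟩ := h v <;> simp [*]

theorem shiftRound_r {Δ p d : ℕ} (hp : p.Prime) (hΔ : Δ < p ^ 2) (s : V → State) (v : V) :
    (freeColors Δ (neighborStates G s v)).card ≤ p * (goodPositions p d
      (freeColors Δ (neighborStates G s v)) (s v).psi (run G [shiftRound Δ p d] s v).r).card := by
  have h := exists_shift (d := d) hp (s v).psi (L := freeColors Δ (neighborStates G s v))
    fun c hc => ((mem_freeColors_neighborStates G).1 hc).1.trans_lt hΔ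
  rw [run_singleton, shiftRound, dif_pos h]
  exact h.choose_spec.2

/-- For each of the first `k` classes, a round that chooses shifts and a round that assigns
colours. -/
noncomputable def classRounds (Δ q p d k : ℕ) : List Round :=
  (List.range k).flatMap fun c => [shiftRound Δ p d, classRound Δ q p d c]

theorem classRounds_succ (Δ q p d k : ℕ) : classRounds Δ q p d (k + 1) =
    classRounds Δ q p d k ++ ([shiftRound Δ p d] ++ [classRound Δ q p d k]) := by
  simp [classRounds, List.range_succ]

open Classical in
/-- If all out-degrees are at most `β`, a vertex that is still uncoloured after the round of its
class has a short list of free colours. Otherwise its shifted polynomial would have passed through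
more than `β * (d + 1)` free colours, and the out-neighbours exclude at most `d + 1` each. -/
theorem classRounds_spec {Δ q p d β : ℕ} (hq : q.Prime) (hp : p.Prime) (hΔ : Δ < p ^ 2)
    {s : V → State} (hs : IsPartialColoring G Δ s)
    (hpsi : IsProperColoring G fun v => (s v).psi) (hpsip : ∀ v, (s v).psi < p ^ d)
    (hβ : ∀ v, (s v).col = none → ((G.neighborFinset v).filter fun u => (s u).col = none ∧
      polyVal q d (s u).psi (s u).t = polyVal q d (s v).psi (s v).t ∧
        (s u).t ≤ (s v).t).card ≤ β) (k : ℕ) :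
    IsPartialColoring G Δ (run G (classRounds Δ q p d k) s) ∧
      Extends s (run G (classRounds Δ q p d k) s) ∧
      ∀ v, (polyVal q d (s v).psi (s v).t).val < k →
        (run G (classRounds Δ q p d k) s v).col = none →
        (freeColors Δ (neighborStates G (run G (classRounds Δ q p d k) s) v)).card ≤
          p * (β * (d + 1)) := by
  induction k with
  | zero => exact ⟨hs, Extends.refl s, fun v hv => absurd hv (Nat.not_lt_zero _)⟩
  | succ k ih =>
    rw [classRounds_succ, run_append, run_append]
    obtain ⟨ih1, ih2, ih3⟩ := ih
    set s₁ := run G (classRounds Δ q p d k) s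
    obtain ⟨e₁, hcol⟩ := shiftRound_extends G (Δ := Δ) (p := p) (d := d) s₁
    have hr := shiftRound_r G (d := d) hp hΔ s₁
    set s₂ := run G [shiftRound Δ p d] s₁
    have hs₂ : IsPartialColoring G Δ s₂ :=
      ⟨fun v c hc => ih1.col_le v c (hcol v ▸ hc),
        fun u v huv c hu hv => ih1.proper u v huv c (hcol u ▸ hu) (hcol v ▸ hv)⟩
    obtain ⟨hs₃, e₂⟩ := classRound_isPartialColoring G (d := d) (c := k) hq hp hs₂
    have e := ih2.trans e₁
    refine ⟨hs₃, e.trans e₂, fun v hvk hv => ?_⟩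
    have hv₂ := e₂.eq_none hv
    refine (Finset.card_le_card (e₂.freeColors_subset G Δ v)).trans ?_
    rcases Nat.lt_succ_iff_lt_or_eq.1 hvk with h | h
    · exact (Finset.card_le_card (e₁.freeColors_subset G Δ v)).trans (ih3 v h (e₁.eq_none hv₂))
    · by_contra! hlt
      have hfree : freeColors Δ (neighborStates G s₁ v) = freeColors Δ (neighborStates G s₂ v) := by
        ext c
        simp only [mem_freeColors_neighborStates, hcol]
      have hrv := hr v
      rw [hfree, ← e₁.psi_eq v] at hrv
      refine classRound_colors G (Δ := Δ) (q := q) (c := k) (β := β) hp (s := s₂) ?_ ?_ hv₂ ?_ ?_ ?_ hv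
      · simpa only [e.psi_eq] using hpsi
      · simpa only [e.psi_eq] using hpsip
      · rw [e.psi_eq, e.t_eq, h]
      · refine le_trans (Finset.card_le_card ?_) (hβ v (e.eq_none hv₂))
        intro u hu
        obtain ⟨hu, hcu, hu'⟩ := Finset.mem_filter.1 hu
        simp only [e.psi_eq, e.t_eq] at hu'
        exact Finset.mem_filter.2 ⟨hu, e.eq_none hcu, hu'⟩
      · exact lt_of_mul_lt_mul_left (hlt.trans_le hrv) (Nat.zero_le p)

/-- The first `k` classes colour themselves greedily, one per round. -/
noncomputable def greedyRounds (Δ q d k : ℕ) : List Round :=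
  (List.range k).map (greedyRound Δ q d)

theorem greedyRounds_succ (Δ q d k : ℕ) :
    greedyRounds Δ q d (k + 1) = greedyRounds Δ q d k ++ [greedyRound Δ q d k] := by
  simp [greedyRounds, List.range_succ]

open Classical in
/-- When all out-degrees are `0`, the uncoloured part of each class is independent, and the greedy
rounds colour all of it. -/
theorem greedyRounds_spec {q d : ℕ} (hq : q.Prime)
    {s : V → State} (hs : IsPartialColoring G G.maxDegree s)
    (hβ : ∀ v, (s v).col = none → ((G.neighborFinset v).filter fun u => (s u).col = none ∧
      polyVal q d (s u).psi (s u).t = polyVal q d (s v).psi (s v).t ∧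
        (s u).t ≤ (s v).t).card = 0) (k : ℕ) :
    IsPartialColoring G G.maxDegree (run G (greedyRounds G.maxDegree q d k) s) ∧
      Extends s (run G (greedyRounds G.maxDegree q d k) s) ∧
      ∀ v, (polyVal q d (s v).psi (s v).t).val < k →
        (run G (greedyRounds G.maxDegree q d k) s v).col ≠ none := by
  have := Fact.mk hq
  -- The uncoloured part of each class is independent.
  have hind : ∀ u v, G.Adj u v → (s u).col = none → (s v).col = none →
      polyVal q d (s u).psi (s u).t ≠ polyVal q d (s v).psi (s v).t := by
    intro u v huv hu hv heq
    rcases le_total (s u).t (s v).t with hle | hle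
    · exact (Finset.eq_empty_iff_forall_notMem.1 (Finset.card_eq_zero.1 (hβ v hv))) u
        (Finset.mem_filter.2 ⟨(G.mem_neighborFinset v u).2 huv.symm, hu, heq, hle⟩)
    · exact (Finset.eq_empty_iff_forall_notMem.1 (Finset.card_eq_zero.1 (hβ u hu))) v
        (Finset.mem_filter.2 ⟨(G.mem_neighborFinset u v).2 huv, hv, heq.symm, hle⟩)
  induction k with
  | zero => exact ⟨hs, Extends.refl s, fun v hv => absurd hv (Nat.not_lt_zero _)⟩
  | succ k ih =>
    rw [greedyRounds_succ, run_append]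
    obtain ⟨ih1, ih2, ih3⟩ := ih
    set s₁ := run G (greedyRounds G.maxDegree q d k) s
    have happ := fun v => greedyRound_apply G.maxDegree q d k (s₁ v) (neighborStates G s₁ v)
    obtain ⟨h1, h2⟩ : IsPartialColoring G G.maxDegree (run G [greedyRound G.maxDegree q d k] s₁) ∧
        Extends s₁ (run G [greedyRound G.maxDegree q d k] s₁) := by
      refine ih1.assign G (fun v => ?_) fun u v huv hu hv e heu hev => ?_
      · rcases happ v with h | ⟨h1, -, h⟩
        · exact Or.inl h
        · exact Or.inr ⟨h1, h⟩
      · rcases happ u with h | ⟨-, hcu, -⟩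
        · rw [run_singleton, h, hu] at heu; exact absurd heu (by simp)
        rcases happ v with h' | ⟨-, hcv, -⟩
        · rw [run_singleton, h', hv] at hev; exact absurd hev (by simp)
        refine hind u v huv (ih2.eq_none hu) (ih2.eq_none hv) (ZMod.val_injective q ?_)
        rw [← ih2.psi_eq, ← ih2.t_eq, hcu, ← ih2.psi_eq, ← ih2.t_eq, hcv]
    refine ⟨h1, ih2.trans h2, fun v hvk hv => ?_⟩
    have hv₁ := h2.eq_none hv
    rcases Nat.lt_succ_iff_lt_or_eq.1 hvk with h | h
    · exact ih3 v h hv₁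
    · have hne : (freeColors G.maxDegree (neighborStates G s₁ v)).Nonempty :=
        Finset.card_pos.1 ((Nat.zero_le _).trans_lt (card_uncolored_lt_card_freeColors G s₁ v))
      rw [run_singleton, greedyRound, dif_pos ⟨hv₁, by rw [ih2.psi_eq, ih2.t_eq, h], hne⟩] at hv
      exact absurd hv (by simp)

end Classes

/-! ### The combined algorithm -/

section Composition

variable {V : Type*} [Fintype V] (G : SimpleGraph V) [DecidableRel G.Adj]

open Classical in
/-- The times `τ` at which the uncoloured vertices join their classes: nothing but the time
changes, and in its class no vertex has more than `β` uncoloured neighbours that joined no later. -/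
theorem trialRounds_spec {q d β : ℕ} (hq : q.Prime) {s : V → State}
    (hs : IsProperColoring G fun v => (s v).psi) (hsq : ∀ v, (s v).psi < q ^ d)
    (hdeg : ∀ v, (s v).col = none →
      ((G.neighborFinset v).filter fun u => (s u).col = none).card * (2 * (d + 1)) <
        q * (β + 1)) :
    ∃ τ : V → ℕ, run G (trialRounds q d β q) s = (fun v => { s v with t := τ v }) ∧
      ∀ v, (s v).col = none → ((G.neighborFinset v).filter fun u => (s u).col = none ∧
        polyVal q d (s u).psi (τ u) = polyVal q d (s v).psi (τ v) ∧ τ u ≤ τ v).card ≤ β :=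
  ⟨fun v => (run G (trialRounds q d β q) s v).t, funext (run_trialRounds_eq G q d β q s),
    fun v hv => trial_outdegree_le G le_rfl s v (trial_lt G hq hs hsq hv (hdeg v hv))⟩

/-- The integer part of the fourth root. -/
def fourthRoot (Δ : ℕ) : ℕ := Δ.sqrt.sqrt

theorem fourthRoot_pow_le (Δ : ℕ) : fourthRoot Δ ^ 4 ≤ Δ := by
  have h1 := Nat.sqrt_le' Δ
  have h2 := Nat.sqrt_le' Δ.sqrt
  calc fourthRoot Δ ^ 4 = (Δ.sqrt.sqrt ^ 2) ^ 2 := by rw [fourthRoot]; ring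
    _ ≤ Δ.sqrt ^ 2 := Nat.pow_le_pow_left h2 2
    _ ≤ Δ := h1

theorem lt_fourthRoot_add_one_pow (Δ : ℕ) : Δ < (fourthRoot Δ + 1) ^ 4 := by
  have h1 := Nat.lt_succ_sqrt' Δ
  have h2 : Δ.sqrt + 1 ≤ (Δ.sqrt.sqrt + 1) ^ 2 := Nat.lt_succ_sqrt' Δ.sqrt
  calc Δ < (Δ.sqrt + 1) ^ 2 := h1
    _ ≤ ((Δ.sqrt.sqrt + 1) ^ 2) ^ 2 := Nat.pow_le_pow_left h2 2
    _ = _ := by rw [fourthRoot]; ring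

theorem fourthRoot_pos {Δ : ℕ} (hΔ : Δ ≠ 0) : 0 < fourthRoot Δ :=
  Nat.sqrt_pos.2 (Nat.sqrt_pos.2 (Nat.pos_of_ne_zero hΔ))

/-- The number of classes. With `b = fourthRoot Δ` and `d = 17`, a neighbour causes at most `2 *
(d + 1) = 36` conflicts, so `36 * Δ < classPrime Δ * (b + 1)` lets all vertices join a class with
out-degrees at most `b`, and `36 * 36 * (b + 1) ^ 3 < classPrime Δ` does so with out-degrees `0`
once the uncoloured degrees are at most `colorPrime Δ * (b * (d + 1)) ≤ 36 * (b + 1) ^ 3`. -/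
noncomputable def classPrime (Δ : ℕ) : ℕ := primeAbove (1296 * (fourthRoot Δ + 1) ^ 3)

/-- The order of a field whose plane has room for the colours `0, …, Δ`. -/
noncomputable def colorPrime (Δ : ℕ) : ℕ := primeAbove ((fourthRoot Δ + 1) ^ 2)

theorem lt_classPrime (Δ : ℕ) : 1296 * (fourthRoot Δ + 1) ^ 3 < classPrime Δ := lt_primeAbove _

theorem lt_colorPrime (Δ : ℕ) : (fourthRoot Δ + 1) ^ 2 < colorPrime Δ := lt_primeAbove _

theorem classPrime_le {Δ : ℕ} (hΔ : Δ ≠ 0) : classPrime Δ ≤ 20736 * fourthRoot Δ ^ 3 := by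
  have h := fourthRoot_pos hΔ
  calc classPrime Δ ≤ 2 * (1296 * (fourthRoot Δ + 1) ^ 3) := primeAbove_le (by positivity)
    _ ≤ 2 * (1296 * (fourthRoot Δ + fourthRoot Δ) ^ 3) := by gcongr; exact h
    _ = _ := by ring

theorem colorPrime_le (Δ : ℕ) : colorPrime Δ ≤ 2 * (fourthRoot Δ + 1) ^ 2 :=
  primeAbove_le (by positivity)

/-- The passage from `(fourthRoot Δ + 1) ^ 34` colours to `Δ + 1` colours. The degree parameter
`17` suffices because both primes exceed `(fourthRoot Δ + 1) ^ 2`. -/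
noncomputable def reductionRounds (Δ : ℕ) : List Round :=
  trialRounds (classPrime Δ) 17 (fourthRoot Δ) (classPrime Δ) ++
    (classRounds Δ (classPrime Δ) (colorPrime Δ) 17 (classPrime Δ) ++
      (trialRounds (classPrime Δ) 17 0 (classPrime Δ) ++
        greedyRounds Δ (classPrime Δ) 17 (classPrime Δ)))

theorem length_reductionRounds (Δ : ℕ) :
    (reductionRounds Δ).length = 5 * classPrime Δ + 2 := by
  simp [reductionRounds, trialRounds, classRounds, greedyRounds, List.length_flatMap]
  ring

theorem reductionRounds_spec {s : V → State}
    (hs : IsProperColoring G fun v => (s v).psi)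
    (hpsi : ∀ v, (s v).psi < (fourthRoot G.maxDegree + 1) ^ 34) (hcol : ∀ v, (s v).col = none) :
    IsPartialColoring G G.maxDegree (run G (reductionRounds G.maxDegree) s) ∧
      ∀ v, (run G (reductionRounds G.maxDegree) s v).col ≠ none := by
  classical
  set Δ := G.maxDegree with hΔ
  set b := fourthRoot Δ with hb
  have hq : (classPrime Δ).Prime := prime_primeAbove _
  have hp : (colorPrime Δ).Prime := prime_primeAbove _
  have hq' := lt_classPrime Δ
  have hp' := lt_colorPrime Δ
  have hple := colorPrime_le Δ
  have hbΔ := lt_fourthRoot_add_one_pow Δ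
  rw [← hb] at hq' hp' hple hbΔ
  rw [reductionRounds, run_append, run_append, run_append, ← hb]
  set q := classPrime Δ with hqdef
  set p := colorPrime Δ with hpdef
  have := Fact.mk hq
  have hpsip : ∀ v, (s v).psi < p ^ 17 := fun v => (hpsi v).trans_le (by
    calc (b + 1) ^ 34 = ((b + 1) ^ 2) ^ 17 := by ring
      _ ≤ p ^ 17 := Nat.pow_le_pow_left hp'.le _)
  have hpsiq : ∀ v, (s v).psi < q ^ 17 := fun v => (hpsi v).trans_le (by
    have : (b + 1) ^ 2 ≤ q := by
      have : (b + 1) ^ 2 ≤ (b + 1) ^ 3 := Nat.pow_le_pow_right (by omega) (by omega)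
      omega
    calc (b + 1) ^ 34 = ((b + 1) ^ 2) ^ 17 := by ring
      _ ≤ q ^ 17 := Nat.pow_le_pow_left this _)
  have hΔp : Δ < p ^ 2 := by
    calc Δ < ((b + 1) ^ 2) ^ 2 := by rw [← pow_mul]; exact hbΔ
      _ ≤ p ^ 2 := Nat.pow_le_pow_left hp'.le _
  obtain ⟨τ, hrun, hτ⟩ := trialRounds_spec G (β := b) hq hs hpsiq (fun v _ => by
    have h1 : ((G.neighborFinset v).filter fun u => (s u).col = none).card ≤ Δ :=
      (Finset.card_filter_le _ _).trans
        ((G.card_neighborFinset_eq_degree v).le.trans (G.degree_le_maxDegree v))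
    calc _ ≤ (b + 1) ^ 4 * (2 * (17 + 1)) := Nat.mul_le_mul_right _ (h1.trans hbΔ.le)
      _ ≤ (1296 * (b + 1) ^ 3) * (b + 1) := by
        rw [show 1296 * (b + 1) ^ 3 * (b + 1) = (b + 1) ^ 4 * 1296 by ring]
        exact Nat.mul_le_mul_left _ (by norm_num)
      _ < q * (b + 1) := Nat.mul_lt_mul_of_pos_right hq' (Nat.succ_pos b))
  rw [hrun]
  obtain ⟨c1, c2, c3⟩ := classRounds_spec G (β := b) (d := 17) (Δ := Δ)
    (s := fun v => { s v with t := τ v }) hq hp hΔp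
    ⟨fun v c hc => by simp [hcol] at hc, fun u v _ c hc => by simp [hcol] at hc⟩ hs hpsip
    (fun v hv => hτ v hv) q
  set s₂ := run G (classRounds Δ q p 17 q) fun v => { s v with t := τ v }
  have hpsi₂ : ∀ v, (s₂ v).psi = (s v).psi := c2.psi_eq
  obtain ⟨σ, hrun', hσ⟩ := trialRounds_spec G (s := s₂) (β := 0) hq
    (by simpa only [hpsi₂] using hs) (by simpa only [hpsi₂] using hpsiq) (fun v hv => by
    have h1 := (card_uncolored_lt_card_freeColors G s₂ v).le.trans (c3 v (ZMod.val_lt _) hv)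
    calc _ ≤ p * (b * (17 + 1)) * (2 * (17 + 1)) := Nat.mul_le_mul_right _ h1
      _ ≤ (2 * (b + 1) ^ 2) * ((b + 1) * (17 + 1)) * (2 * (17 + 1)) := by gcongr; omega
      _ = 1296 * (b + 1) ^ 3 := by ring
      _ < q * (0 + 1) := by omega)
  rw [hrun']
  obtain ⟨g1, -, g3⟩ := greedyRounds_spec G (s := fun v => { s₂ v with t := σ v }) (d := 17) hq
    ⟨c1.col_le, c1.proper⟩ (fun v hv => Nat.le_zero.1 (hσ v hv)) q
  exact ⟨g1, fun v => g3 v (ZMod.val_lt _)⟩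

/-- The whole algorithm for `2 ≤ Δ`. One application of the logarithm less than `log* n` leaves a
number that is at most `2`, so `logStar n - 1` rounds of Linial's reduction suffice. -/
noncomputable def coloringRounds (n Δ : ℕ) : List Round :=
  linialRounds Δ n (logStar n - 1) ++ reductionRounds Δ

theorem linialRounds_col (Δ n k : ℕ) (s : V → State) (hs : ∀ v, (s v).col = none) (v : V) :
    (run G (linialRounds Δ n k) s v).col = none := by
  refine run_induction G (I := fun s => ∀ v, (s v).col = none) hs (fun f hf s hs v => ?_) v
  obtain ⟨i, -, rfl⟩ := List.mem_map.1 hf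
  rw [run_singleton]
  rcases linialRound_apply (primeAbove (Δ * ((linialCount Δ n i).size + 1)))
    (linialCount Δ n i).size (s v) (neighborStates G s v) with h | ⟨x, -, h⟩ <;> rw [h] <;>
    exact hs v

theorem run_coloringRounds {n : ℕ} (hΔ : G.maxDegree ≠ 0) (hn : 2 ≤ n) {s : V → State}
    (hs : IsProperColoring G fun v => (s v).psi) (hsn : ∀ v, (s v).psi < n)
    (hcol : ∀ v, (s v).col = none) :
    IsPartialColoring G G.maxDegree (run G (coloringRounds n G.maxDegree) s) ∧
      ∀ v, (run G (coloringRounds n G.maxDegree) s v).col ≠ none := by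
  have hL : logStar n ≠ 0 := logStar_ne_zero hn
  obtain ⟨h1, h2⟩ := linialRounds_spec G hs hsn (logStar n - 1)
  rw [coloringRounds, run_append]
  refine reductionRounds_spec G h1 (fun v => (h2 v).trans_le ?_)
    (linialRounds_col G _ _ _ s hcol)
  have hb := fourthRoot_pos hΔ
  have hbΔ := lt_fourthRoot_add_one_pow G.maxDegree
  set b := fourthRoot G.maxDegree
  calc linialCount G.maxDegree n (logStar n - 1) ≤ 4 * (16 * (G.maxDegree + 1)) ^ 4 :=
        linialCount_final_le hΔ (by omega) hL
    _ ≤ 4 * (16 * (b + 1) ^ 4) ^ 4 := by gcongr; omega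
    _ = 2 ^ 18 * (b + 1) ^ 16 := by ring
    _ ≤ (b + 1) ^ 18 * (b + 1) ^ 16 := by gcongr; omega
    _ = (b + 1) ^ 34 := by ring

theorem psi_eq_of_mem_reductionRounds {Δ : ℕ} {f : Round} (hf : f ∈ reductionRounds Δ)
    (s : State) (M : Multiset State) : (f s M).psi = s.psi := by
  have htrial : ∀ q d β k, f ∈ trialRounds q d β k → (f s M).psi = s.psi := by
    intro q d β k hf
    rcases List.mem_cons.1 hf with rfl | hf
    · rfl
    · obtain ⟨i, -, rfl⟩ := List.mem_map.1 hf
      rcases trialRound_apply q d β i s M with h | h <;> rw [h]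
  simp only [reductionRounds, List.mem_append] at hf
  rcases hf with hf | hf | hf | hf
  · exact htrial _ _ _ _ hf
  · obtain ⟨c, -, hf⟩ := List.mem_flatMap.1 hf
    simp only [List.mem_cons, List.not_mem_nil, or_false] at hf
    rcases hf with rfl | rfl
    · rcases shiftRound_apply Δ (colorPrime Δ) 17 s M with h | ⟨r, -, h⟩ <;> rw [h]
    · rcases classRound_apply Δ (classPrime Δ) (colorPrime Δ) 17 c s M with
        h | ⟨-, -, x, -, -, h⟩ <;> rw [h]
  · exact htrial _ _ _ _ hf
  · obtain ⟨c, -, rfl⟩ := List.mem_map.1 hf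
    rcases greedyRound_apply Δ (classPrime Δ) 17 c s M with h | ⟨-, -, x, -, h⟩ <;> rw [h]

theorem isProperColoring_psi_take {n : ℕ} {s : V → State}
    (hs : IsProperColoring G fun v => (s v).psi) (hsn : ∀ v, (s v).psi < n) (k : ℕ) :
    IsProperColoring G
      fun v => (run G ((coloringRounds n G.maxDegree).take k) s v).psi := by
  rw [coloringRounds, List.take_append, run_append]
  have htake : (linialRounds G.maxDegree n (logStar n - 1)).take k =
      linialRounds G.maxDegree n (min k (logStar n - 1)) := by
    rw [linialRounds, ← List.map_take, List.take_range, linialRounds]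
  rw [htake]
  refine run_induction G (I := fun s => IsProperColoring G fun v => (s v).psi)
    (linialRounds_spec G hs hsn _).1 fun f hf s hs => ?_
  simpa only [run_singleton, psi_eq_of_mem_reductionRounds (List.mem_of_mem_take hf)] using hs

end Composition

/-! ### Sizes of the parameters -/

theorem logStar_le (n : ℕ) : logStar n ≤ n := by
  have key : ∀ m : ℕ, ∀ x : ℝ, x ≤ m → ∃ k ≤ m, (Real.logb 2)^[k] x ≤ 1 := by
    intro m
    induction m with
    | zero => intro x hx; exact ⟨0, le_rfl, by simpa using hx.trans (by norm_num)⟩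
    | succ m ih =>
      intro x hx
      by_cases h1 : x ≤ 1
      · exact ⟨0, by omega, by simpa using h1⟩
      push Not at h1
      by_cases h2 : x ≤ 2
      · refine ⟨1, by omega, ?_⟩
        rw [Function.iterate_one, Real.logb_le_iff_le_rpow (by norm_num) (by linarith)]
        simpa using h2
      push Not at h2
      have hb : Real.logb 2 x ≤ m := by
        rw [Real.logb_le_iff_le_rpow (by norm_num) (by linarith), Real.rpow_natCast]
        have : m + 1 ≤ 2 ^ m := Nat.lt_two_pow_self
        have h3 : ((m + 1 : ℕ) : ℝ) ≤ ((2 ^ m : ℕ) : ℝ) := by exact_mod_cast this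
        push_cast at h3 hx
        linarith
      obtain ⟨k, hk, hk'⟩ := ih _ hb
      exact ⟨k + 1, by omega, by simpa using hk'⟩
  obtain ⟨k, hk, hk'⟩ := key n n le_rfl
  exact (Nat.sInf_le hk').trans hk

theorem linialCount_le_pow {Δ n k : ℕ} (hΔ : Δ ≠ 0) (hn : 2 ≤ n) (hΔn : Δ + 1 ≤ n)
    (hk : k < logStar n) : linialCount Δ n k ≤ n ^ 22 := by
  have h1 := linialCount_le hΔ (by omega) hk
  have h2 : (linialCount Δ n k : ℝ) ≤ (16 * (Δ + 1)) ^ 4 * n ^ 2 :=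
    h1.trans (by
      have := iterate_logb_gt_one hk
      have := iterate_logb_le hk
      gcongr)
  have h3 : linialCount Δ n k ≤ (16 * (Δ + 1)) ^ 4 * n ^ 2 := by exact_mod_cast h2
  calc _ ≤ (2 ^ 4 * n) ^ 4 * n ^ 2 := h3.trans (by gcongr; norm_num)
    _ ≤ (n ^ 4 * n) ^ 4 * n ^ 2 := by gcongr
    _ = n ^ 22 := by ring

theorem classPrime_lt_pow {Δ n : ℕ} (hΔ : Δ ≠ 0) (hn : 2 ≤ n) (hΔn : Δ + 1 ≤ n) :
    classPrime Δ < n ^ 16 := by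
  have h1 := classPrime_le hΔ
  have h2 := fourthRoot_pow_le Δ
  have h3 : fourthRoot Δ ^ 3 ≤ fourthRoot Δ ^ 4 :=
    Nat.pow_le_pow_right (fourthRoot_pos hΔ) (by omega)
  calc _ < 2 ^ 15 * n := by omega
    _ ≤ n ^ 15 * n := by gcongr
    _ = n ^ 16 := by ring

theorem length_coloringRounds_le (Δ n : ℕ) :
    (coloringRounds n Δ).length ≤ logStar n + 6 * classPrime Δ := by
  have := lt_classPrime Δ
  rw [coloringRounds, List.length_append, length_reductionRounds, linialRounds, List.length_map,
    List.length_range]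
  have : 0 < (fourthRoot Δ + 1) ^ 3 := by positivity
  omega

/-- The exponent `24` is large enough for all numbers that occur: Linial's reduction never has more
than `n ^ 22` colours, and `n ^ 16` exceeds the two primes. -/
theorem boundedBy_of_mem_coloringRounds {Δ n : ℕ} (hΔ : Δ ≠ 0) (hn : 2 ≤ n) (hΔn : Δ + 1 ≤ n)
    {f : Round} (hf : f ∈ coloringRounds n Δ) {s : State} (hs : s.BoundedBy (n ^ 24))
    (M : Multiset State) : (f s M).BoundedBy (n ^ 24) := by
  have hpow : ∀ {i j : ℕ}, i ≤ j → n ^ i ≤ n ^ j := fun h => Nat.pow_le_pow_right (by omega) h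
  have hq := (classPrime_lt_pow hΔ hn hΔn).trans_le (hpow (show 16 ≤ 24 by omega))
  have hp : colorPrime Δ ≤ classPrime Δ := by
    have h1 := colorPrime_le Δ
    have h2 := lt_classPrime Δ
    have : (fourthRoot Δ + 1) ^ 2 ≤ (fourthRoot Δ + 1) ^ 3 :=
      Nat.pow_le_pow_right (by omega) (by omega)
    omega
  have hfree : ∀ c ∈ freeColors Δ M, c + 1 < n ^ 24 := by
    intro c hc
    have h1 := Finset.mem_range.1 (Finset.mem_filter.1 hc).1
    have h2 : n ^ 2 ≤ n ^ 24 := hpow (by omega)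
    nlinarith
  have htrial : ∀ d β, f ∈ trialRounds (classPrime Δ) d β (classPrime Δ) →
      (f s M).BoundedBy (n ^ 24) := by
    intro d β hf
    rcases List.mem_cons.1 hf with rfl | hf
    · exact ⟨hs.1, hq, hs.3, hs.4⟩
    · obtain ⟨i, hi, rfl⟩ := List.mem_map.1 hf
      have hi := List.mem_range.1 hi
      rcases trialRound_apply (classPrime Δ) d β i s M with h | h <;> rw [h]
      · exact hs
      · exact ⟨hs.1, hi.trans hq, hs.3, hs.4⟩
  simp only [coloringRounds, reductionRounds, List.mem_append] at hf
  rcases hf with hf | hf | hf | hf | hf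
  · obtain ⟨i, hi, rfl⟩ := List.mem_map.1 hf
    have hi := List.mem_range.1 hi
    have hi' := linialCount_le_pow (k := i + 1) hΔ hn hΔn (by omega)
    rw [linialCount] at hi'
    have hprime := prime_primeAbove (Δ * ((linialCount Δ n i).size + 1))
    have := Fact.mk hprime
    rcases linialRound_apply (primeAbove (Δ * ((linialCount Δ n i).size + 1)))
      (linialCount Δ n i).size s M with h | ⟨x, hx, h⟩ <;> rw [h]
    · exact hs
    · exact ⟨(Nat.pair_lt_sq hx (ZMod.val_lt _)).trans_le (hi'.trans (hpow (by omega))),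
        hs.2, hs.3, hs.4⟩
  · exact htrial _ _ hf
  · obtain ⟨c, -, hf⟩ := List.mem_flatMap.1 hf
    simp only [List.mem_cons, List.not_mem_nil, or_false] at hf
    rcases hf with rfl | rfl
    · rcases shiftRound_apply Δ (colorPrime Δ) 17 s M with h | ⟨r, hr, h⟩ <;> rw [h]
      · exact hs
      · exact ⟨hs.1, hs.2, hr.trans (hp.trans_lt hq), hs.4⟩
    · rcases classRound_apply Δ (classPrime Δ) (colorPrime Δ) 17 c s M with
        h | ⟨-, -, x, hx, -, h⟩ <;> rw [h]
      · exact hs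
      · refine ⟨hs.1, hs.2, hs.3, fun c' hc' => ?_⟩
        rw [← Option.some.inj hc']
        exact hfree _ (Finset.mem_filter.1 hx).2
  · exact htrial _ _ hf
  · obtain ⟨c, -, rfl⟩ := List.mem_map.1 hf
    rcases greedyRound_apply Δ (classPrime Δ) 17 c s M with h | ⟨-, -, x, hx, h⟩ <;> rw [h]
    · exact hs
    · refine ⟨hs.1, hs.2, hs.3, fun c' hc' => ?_⟩
      rw [← Option.some.inj hc']
      exact hfree _ hx

/-! ### From rounds to the rule -/

section Final

variable {V : Type*} [Fintype V] (G : SimpleGraph V) [DecidableRel G.Adj]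

/-- What a list of rounds has to satisfy for its rule to be a correct locally-iterative colouring
with small messages. The entry `psi` makes the broadcast colours proper until the last round. -/
theorem ruleOfRounds_spec {Δ B : ℕ} {P : List Round} (hP : P ≠ []) (hlen : P.length ≤ B ^ 8)
    {ident : V → ℕ} (hident : ∀ v, ident v < B) (hB : 0 < B)
    (hbdd : ∀ f ∈ P, ∀ s M, s.BoundedBy B → (f s M).BoundedBy B)
    (hproper : ∀ k < P.length,
      IsProperColoring G fun v => (run G (P.take k) (fun v => ⟨ident v, 0, 0, none⟩) v).psi)
    (hfin : IsPartialColoring G Δ (run G P fun v => ⟨ident v, 0, 0, none⟩))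
    (hcol : ∀ v, (run G P (fun v => ⟨ident v, 0, 0, none⟩) v).col ≠ none) :
    (∀ t, IsProperColoring G ((ruleOfRounds Δ P).color G ident t)) ∧
      (∀ t v, (ruleOfRounds Δ P).color G ident t v < Δ + 1 + B ^ 16) ∧
      (∀ v, (ruleOfRounds Δ P).color G ident P.length v < Δ + 1) ∧
      ∀ t v, P.length ≤ t → (ruleOfRounds Δ P).color G ident t v =
        (ruleOfRounds Δ P).color G ident P.length v := by
  choose φ hφ using fun v => Option.ne_none_iff_exists'.1 (hcol v)
  have hφΔ : ∀ v, φ v ≤ Δ := fun v => hfin.col_le v _ (hφ v)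
  have hge := fun t ht => color_ruleOfRounds_of_ge G hP ident hφ hφΔ t ht
  have hlt := fun t ht => color_ruleOfRounds_of_lt G (Δ := Δ) (P := P) ident t ht
  refine ⟨fun t u v huv => ?_, fun t v => ?_, fun v => ?_, fun t v ht => ?_⟩
  · rcases lt_or_ge t P.length with ht | ht
    · rw [hlt t ht, hlt t ht]
      intro h
      have h1 := Nat.add_left_cancel h
      rw [Nat.pair_eq_pair] at h1
      have h2 := congrArg State.decode h1.2
      rw [State.decode_encode, State.decode_encode] at h2
      exact hproper t ht u v huv (congrArg State.psi h2)
    · rw [hge t ht, hge t ht]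
      intro h
      exact hfin.proper u v huv (φ u) (hφ u) (h ▸ hφ v)
  · rcases lt_or_ge t P.length with ht | ht
    · rw [hlt t ht]
      have hb : ∀ v, (run G (P.take t) (fun v => ⟨ident v, 0, 0, none⟩) v).BoundedBy B :=
        run_induction G (I := fun s => ∀ v, (s v).BoundedBy B)
          (fun v => ⟨hident v, hB, hB, fun c hc => absurd hc (by simp)⟩)
          fun f hf s hs v => hbdd f (List.mem_of_mem_take hf) _ _ (hs v)
      have h1 := Nat.pair_lt_sq (ht.trans_le hlen) (hb v).encode_lt
      rw [← pow_mul, show 8 * 2 = 16 from rfl] at h1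
      omega
    · rw [hge t ht]
      have := hφΔ v
      have := Nat.pow_pos (n := 16) hB
      omega
  · rw [hge _ le_rfl]
    exact Nat.lt_succ_of_le (hφΔ v)
  · rw [hge t ht, hge _ le_rfl]

theorem size_le_mul_logb {n c k : ℕ} (hn : 2 ≤ n) (hc : c ≤ n ^ k) :
    (c.size : ℝ) ≤ (k + 1) * Real.logb 2 n := by
  have hlog : 1 ≤ Real.logb 2 n := by
    rw [Real.le_logb_iff_rpow_le (by norm_num) (by exact_mod_cast (by omega : 0 < n)),
      Real.rpow_one]
    exact_mod_cast hn
  rcases Nat.eq_zero_or_pos c with rfl | hc0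
  · rw [Nat.size_zero, Nat.cast_zero]
    positivity
  · have h1 := size_le_logb_add_one hc0.ne'
    have h2 : Real.logb 2 c ≤ k * Real.logb 2 n := by
      rw [← Real.logb_pow]
      exact Real.logb_le_logb_of_le (by norm_num) (by exact_mod_cast hc0) (by exact_mod_cast hc)
    linarith

theorem fourthRoot_pow_three_le (Δ : ℕ) : (fourthRoot Δ : ℝ) ^ 3 ≤ (Δ : ℝ) ^ (3 / 4 : ℝ) := by
  have h : (fourthRoot Δ : ℝ) ^ 4 ≤ Δ := by exact_mod_cast fourthRoot_pow_le Δ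
  calc (fourthRoot Δ : ℝ) ^ 3 = ((fourthRoot Δ : ℝ) ^ 4) ^ (3 / 4 : ℝ) := by
        rw [← Real.rpow_natCast, ← Real.rpow_natCast, ← Real.rpow_mul (Nat.cast_nonneg _)]
        norm_num
    _ ≤ _ := Real.rpow_le_rpow (by positivity) h (by norm_num)

open Classical in
/-- In a matching, the vertex with the smaller `psi` of each edge gets colour `0`, its partner
`1`. -/
noncomputable def matchingRound : Round := fun s M =>
  { s with col := some (if ∃ s' ∈ M, s'.psi < s.psi then 1 else 0) }

theorem isPartialColoring_matchingRound (hΔ : G.maxDegree = 1) {s : V → State}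
    (hs : IsProperColoring G fun v => (s v).psi) :
    IsPartialColoring G 1 (run G [matchingRound] s) := by
  classical
  have key : ∀ u v, G.Adj u v → (s u).psi < (s v).psi →
      (run G [matchingRound] s u).col = some 0 ∧ (run G [matchingRound] s v).col = some 1 := by
    intro u v huv hlt
    simp only [run_singleton, matchingRound, mem_neighborStates]
    rw [if_neg, if_pos]
    · exact ⟨rfl, rfl⟩
    · exact ⟨_, ⟨u, huv.symm, rfl⟩, hlt⟩
    · rintro ⟨-, ⟨w, huw, rfl⟩, hw⟩
      have hd : (G.neighborFinset u).card ≤ 1 := by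
        rw [G.card_neighborFinset_eq_degree, ← hΔ]
        exact G.degree_le_maxDegree u
      have := Finset.card_le_one.1 hd v ((G.mem_neighborFinset u v).2 huv) w
        ((G.mem_neighborFinset u w).2 huw)
      subst this
      omega
  refine ⟨fun v c hc => ?_, fun u v huv c hu hv => ?_⟩
  · simp only [run_singleton, matchingRound, Option.some.injEq] at hc
    split_ifs at hc <;> omega
  · rcases lt_or_gt_of_ne (hs u v huv) with h | h
    · obtain ⟨h1, h2⟩ := key u v huv h
      rw [h1] at hu; rw [h2, ← hu] at hv; exact absurd hv (by simp)
    · obtain ⟨h1, h2⟩ := key v u huv.symm h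
      rw [h2] at hu; rw [h1, ← hu] at hv; exact absurd hv (by simp)

end Final

open Classical in
/-- The rule for `n` vertices and maximum degree `Δ`. The cases `Δ ≤ 1` are separate because there
the time bound is `log* n`, without any constant to spare. -/
noncomputable def coloringRule (n Δ : ℕ) : LocallyIterativeRule :=
  if Δ = 0 then ⟨fun _ => 0, fun _ _ => 0⟩
  else ruleOfRounds Δ (if Δ = 1 then [matchingRound] else coloringRounds n Δ)

theorem theorem1 :
    ∃ (A : ℕ → ℕ → LocallyIterativeRule) (C : ℝ),
      ∀ (n Δ : ℕ) (V : Type*) [Fintype V] (G : SimpleGraph V) [DecidableRel G.Adj]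
        (ident : V → Fin n),
        Fintype.card V = n → G.maxDegree = Δ → Function.Injective ident →
        -- every round has a proper coloring
        (∀ t : ℕ, IsProperColoring G ((A n Δ).color G (fun v => (ident v : ℕ)) t)) ∧
        -- the broadcast messages, which are the colors in binary, have `O(log n)` bits
        (∀ (t : ℕ) (v : V),
          (Nat.size ((A n Δ).color G (fun v => (ident v : ℕ)) t v) : ℝ)
            ≤ C * Real.logb 2 (n : ℝ)) ∧
        -- after `T` rounds all vertices have colors in `{0, …, Δ}` and no color changes any more
        (∃ T : ℕ,
          (T : ℝ) ≤ C * ((Δ : ℝ) ^ (3 / 4 : ℝ) * Real.logb 2 (Δ : ℝ)) + (logStar n : ℝ) ∧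
          (∀ v : V, (A n Δ).color G (fun v => (ident v : ℕ)) T v < Δ + 1) ∧
          (∀ (t : ℕ) (v : V), T ≤ t →
            (A n Δ).color G (fun v => (ident v : ℕ)) t v
              = (A n Δ).color G (fun v => (ident v : ℕ)) T v)) := by
  refine ⟨coloringRule, 124416, ?_⟩
  intro n Δ V _ G _ ident hcard hdeg hinj
  rcases Nat.eq_zero_or_pos Δ with rfl | hΔ
  · have hcolor : ∀ t v, (coloringRule n 0).color G (fun v => (ident v : ℕ)) t v = 0 := by
      intro t v
      rw [coloringRule, if_pos rfl]
      cases t <;> rfl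
    refine ⟨fun t u v huv => ?_, fun t v => ?_, 0, ?_, fun v => ?_, fun t v _ => ?_⟩
    · have h1 := G.degree_le_maxDegree u
      have h2 := (G.degree_pos_iff_exists_adj u).2 ⟨v, huv⟩
      omega
    · rw [hcolor, Nat.size_zero, Nat.cast_zero]
      have : (1 : ℝ) ≤ n := by exact_mod_cast (ident v).pos
      have := Real.logb_nonneg (b := 2) (by norm_num) this
      positivity
    · simp
    · rw [hcolor]; exact Nat.one_pos
    · rw [hcolor, hcolor]
  have hne : Nonempty V := by
    by_contra h
    rw [not_nonempty_iff] at h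
    rw [G.maxDegree_of_subsingleton] at hdeg
    omega
  have hΔn : Δ + 1 ≤ n := by
    rw [← hcard, ← hdeg]
    exact G.maxDegree_lt_card_verts
  have hn : 2 ≤ n := by omega
  have hinit : IsProperColoring G fun v => (ident v : ℕ) := fun u v huv h =>
    huv.ne (hinj (Fin.ext h))
  have hpow : ∀ {i j : ℕ}, i ≤ j → n ^ i ≤ n ^ j := fun h => Nat.pow_le_pow_right (by omega) h
  have hident : ∀ v, (ident v : ℕ) < n ^ 24 := fun v =>
    (ident v).isLt.trans_le (Nat.le_self_pow (by norm_num) n)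
  have hsize : ∀ c, c < Δ + 1 + (n ^ 24) ^ 16 → (c.size : ℝ) ≤ 124416 * Real.logb 2 n := by
    intro c hc
    have h1 : c ≤ n ^ (24 * 16 + 1) := by
      have h2 : n ≤ (n ^ 24) ^ 16 :=
        (Nat.le_self_pow (by norm_num) n).trans (Nat.le_self_pow (by norm_num) _)
      rw [pow_succ, pow_mul]
      generalize (n ^ 24) ^ 16 = N at *
      nlinarith
    have h2 := size_le_mul_logb hn h1
    have : 0 ≤ Real.logb 2 (n : ℝ) :=
      Real.logb_nonneg (by norm_num) (by exact_mod_cast (by omega : 1 ≤ n))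
    push_cast at h2
    linarith
  by_cases hΔ1 : Δ = 1
  · subst hΔ1
    obtain ⟨h1, h2, h3, h4⟩ := ruleOfRounds_spec G (Δ := 1) (B := n ^ 24) (P := [matchingRound])
      (ident := fun v => (ident v : ℕ)) (by simp)
      (show 1 ≤ (n ^ 24) ^ 8 from Nat.pow_pos (Nat.pow_pos (by omega))) hident
      (Nat.pow_pos (by omega)) (by
        intro f hf s M hs
        rw [List.mem_singleton.1 hf]
        refine ⟨hs.1, hs.2, hs.3, fun c hc => ?_⟩
        simp only [matchingRound, Option.some.injEq] at hc
        have : 2 ^ 2 ≤ n ^ 24 := (Nat.pow_le_pow_left hn 2).trans (hpow (by omega))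
        split_ifs at hc <;> omega) (by
        intro k hk
        obtain rfl : k = 0 := by simpa using hk
        exact hinit) (isPartialColoring_matchingRound G hdeg hinit) (by
        intro v
        simp [run_singleton, matchingRound])
    rw [show coloringRule n 1 = ruleOfRounds 1 [matchingRound] by simp [coloringRule]]
    refine ⟨h1, fun t v => hsize _ (h2 t v), 1, ?_, h3, h4⟩
    have hL : logStar n ≠ 0 := logStar_ne_zero hn
    have : (1 : ℝ) ≤ logStar n := by exact_mod_cast Nat.pos_of_ne_zero hL
    simpa using this
  · have hΔ0 : Δ ≠ 0 := hΔ.ne'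
    have hlen := length_coloringRounds_le Δ n
    subst hdeg
    set Δ := G.maxDegree with hΔdef
    obtain ⟨r1, r2⟩ := run_coloringRounds G (n := n) (s := fun v => ⟨(ident v : ℕ), 0, 0, none⟩)
      hΔ0 hn hinit (fun v => (ident v).isLt) fun _ => rfl
    obtain ⟨h1, h2, h3, h4⟩ := ruleOfRounds_spec G (Δ := Δ) (B := n ^ 24)
      (P := coloringRounds n Δ) (ident := fun v => (ident v : ℕ)) (by
        rw [← List.length_pos_iff, coloringRounds, List.length_append, length_reductionRounds]
        omega) (by
        have hq := classPrime_lt_pow hΔ0 hn hΔn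
        have hL := logStar_le n
        have h3 : n ≤ n ^ 16 := Nat.le_self_pow (by norm_num) n
        calc _ ≤ 2 ^ 3 * n ^ 16 := by omega
          _ ≤ n ^ 3 * n ^ 16 := by gcongr
          _ = n ^ 19 := by ring
          _ ≤ n ^ (24 * 8) := hpow (by norm_num)
          _ = _ := by rw [pow_mul]) hident
      (Nat.pow_pos (by omega))
      (fun f hf s M hs => boundedBy_of_mem_coloringRounds hΔ0 hn hΔn hf hs M)
      (fun k _ => isProperColoring_psi_take G hinit (fun v => (ident v).isLt) k) r1 r2
    rw [show coloringRule n Δ = ruleOfRounds Δ (coloringRounds n Δ) by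
      simp [coloringRule, hΔ0, hΔ1]]
    refine ⟨h1, fun t v => hsize _ (h2 t v), _, ?_, h3, h4⟩
    have e1 : ((coloringRounds n Δ).length : ℝ) ≤ logStar n + 6 * classPrime Δ := by
      exact_mod_cast hlen
    have e2 : (classPrime Δ : ℝ) ≤ 20736 * fourthRoot Δ ^ 3 := by
      exact_mod_cast classPrime_le hΔ0
    have e3 := fourthRoot_pow_three_le Δ
    have e4 : 1 ≤ Real.logb 2 (Δ : ℝ) := by
      rw [Real.le_logb_iff_rpow_le (by norm_num) (by exact_mod_cast hΔ), Real.rpow_one]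
      exact_mod_cast (by omega : 2 ≤ Δ)
    have e5 : (Δ : ℝ) ^ (3 / 4 : ℝ) ≤ (Δ : ℝ) ^ (3 / 4 : ℝ) * Real.logb 2 (Δ : ℝ) :=
      le_mul_of_one_le_right (by positivity) e4
    linarith
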